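/- Let $r\geq 2$ be even and $m=r/2$. Let $S^r(\mathbb C^2)$ be the $r$-th symmetric power of the standard representation, with basis $x_0,\dots,x_r$, where $x_0=e_0^r$ is a maximal weight vector and $x_i=Y^ix_0/i!$ for $Y=\left(\begin{smallmatrix}0&0\\1&0\end{smallmatrix}\right)\in\mathfrak{sl}_2(\mathbb C)$. Let $\mathbb P^r=\mathbb P S^r(\mathbb C^2)$ with homogeneous coordinates $(a_0:\dots:a_r)$ with respect to this basis and the Zariski topology. There is a nonzero $\mathfrak{sl}_2(\mathbb C)$-linear map (the projection) $f_m:S^2(S^r(\mathbb C^2))\to S^{2r-4m}(\mathbb C^2)=S^0(\mathbb C^2)$. For any such map let $M_m=\{x\in\mathbb P^r : f_m(xx)=0\}$. Then: (1) $f_m=q_0w_0$, where $w_0$ spans $S^0(\mathbb C^2)$ and $q_0$ is a symmetric bilinear form, so $M_m$ is the zero locus of the single quadratic form $q_0$. There is $\lambda\in\mathbb C\setminus\{0\}$ such that $q_0(x_i,x_{r-i})=\lambda(-1)^i\binom ri$ for $0\leq i\leq r$ and $q_0(x_i,x_j)=0$ if $i+j\neq r$; that is, the matrix of $q_0$ is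 antidiagonal with entries $\lambda(-1)^i\binom ri$. This matrix has full rank $r+1$. (2) $M_m$ is the unique quadric of $\mathbb P^r$ (zero locus of a nonzero quadratic form) that is invariant under $PGL_2(\mathbb C)$. Moreover, the zero locus of a nonzero quadratic form $Q$ is $PGL_2(\mathbb C)$-invariant if and only if $Q=c\,q_0$ for some $c\in\mathbb C\setminus\{0\}$. (3) $M_m$ is irreducible of dimension $r-1$. (4) Let $c_r\subseteq\mathbb P^r$ be the Veronese curve, the closure of the points $c_r(t)=(1:t:t^2:\dots:t^r)$, $t\in\mathbb C$, and let $T^pc_r$ be its $p$-osculating variety, the closure of the points $c_r(t)+\lambda_1c_r'(t)+\dots+\lambda_pc_r^{(p)}(t)$ with $t,\lambda_1,\dots,\lambda_p\in\mathbb C$. If $r>2$, then $T^{\frac r2-1}c_r\subsetneq M_m$. If $r=2$, then $c_2=M_m$. -/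

import Mathlib

open scoped LinearAlgebra.Projectivization MatrixGroups Nat

noncomputable section

namespace BinaryForms

open MvPolynomial

/-- `S^r(ℂ²)`: binary forms of degree `r` in the basis `e₀ = X 0`, `e₁ = X 1` of `ℂ²`. -/
abbrev BinForm (r : ℕ) : Type := ↥(homogeneousSubmodule (Fin 2) ℂ r)

/-- The image `A e_j = ∑ i, A i j e_i` of the `j`-th basis vector of `ℂ²`. -/
def linForm (A : Matrix (Fin 2) (Fin 2) ℂ) (j : Fin 2) : MvPolynomial (Fin 2) ℂ :=
  ∑ i, A i j • X i

lemma linForm_homogeneous (A : Matrix (Fin 2) (Fin 2) ℂ) (j : Fin 2) :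
    (linForm A j).IsHomogeneous 1 :=
  IsHomogeneous.sum _ _ _ fun i _ => by
    rw [smul_eq_C_mul]; exact isHomogeneous_C_mul_X _ _

/-! ### The group action -/

lemma subst_homogeneous (A : Matrix (Fin 2) (Fin 2) ℂ) {r : ℕ} (p : BinForm r) :
    (aeval (linForm A) p.1).IsHomogeneous r := by
  simpa using IsHomogeneous.aeval (m := r) p.2 _ (linForm_homogeneous A)

/-- The symmetric power `S^r(A)` of a linear map `A` of `ℂ²`. -/
def symPow (r : ℕ) (A : Matrix (Fin 2) (Fin 2) ℂ) : BinForm r →ₗ[ℂ] BinForm r where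
  toFun p := ⟨aeval (linForm A) p.1, subst_homogeneous A p⟩
  map_add' p q := Subtype.ext (by simp)
  map_smul' c p := Subtype.ext (by simp)

lemma symPow_one (r : ℕ) : symPow r 1 = LinearMap.id := by
  ext1 p
  apply Subtype.ext
  have h : linForm 1 = X := by
    funext j
    simp [linForm, Matrix.one_apply, ite_smul]
  change aeval (linForm 1) p.1 = p.1
  rw [h]; simp

lemma symPow_mul (r : ℕ) (A B : Matrix (Fin 2) (Fin 2) ℂ) :
    symPow r (A * B) = symPow r A ∘ₗ symPow r B := by
  ext1 p
  apply Subtype.ext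
  change aeval (linForm (A * B)) p.1 = aeval (linForm A) (aeval (linForm B) p.1)
  rw [← AlgHom.comp_apply]
  congr 1
  apply MvPolynomial.algHom_ext
  intro j
  simp only [AlgHom.comp_apply, aeval_X]
  fin_cases j <;>
  · simp [linForm, Fin.sum_univ_two, Matrix.mul_apply, smul_eq_C_mul]; ring

lemma symPow_scalar (r : ℕ) (u : ℂˣ) (p : BinForm r) :
    symPow r (Matrix.scalar (Fin 2) (u : ℂ)) p = (u : ℂ) ^ r • p := by
  apply Subtype.ext
  have h : linForm (Matrix.scalar (Fin 2) (u : ℂ)) = fun j => C (u : ℂ) * X j := by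
    funext j
    simp [linForm, Matrix.diagonal_apply, ite_smul, smul_eq_C_mul]
  change aeval (linForm (Matrix.scalar (Fin 2) (u : ℂ))) p.1 = (u : ℂ) ^ r • p.1
  rw [h]
  conv_lhs => rw [p.1.as_sum]
  conv_rhs => rw [p.1.as_sum]
  rw [map_sum, Finset.smul_sum]
  refine Finset.sum_congr rfl fun d hd => ?_
  have hdeg : d 0 + d 1 = r := by
    have := p.2 (mem_support_iff.mp hd)
    simpa [Finsupp.weight_apply, Finsupp.sum_fintype, Fin.sum_univ_two] using this
  rw [aeval_monomial, monomial_eq, smul_eq_C_mul,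
    show (u : ℂ) ^ r = u ^ (d 0 + d 1) by rw [hdeg]]
  simp [Finsupp.prod_fintype, Fin.prod_univ_two, mul_pow, pow_add, algebraMap_eq]
  ring

/-- The representation of `GL₂(ℂ)` on `S^r(ℂ²)`. -/
def glRep (r : ℕ) : Representation ℂ (GL (Fin 2) ℂ) (BinForm r) where
  toFun g := symPow r g.1
  map_one' := symPow_one r
  map_mul' g h := symPow_mul r g.1 h.1

lemma glRep_injective (r : ℕ) (g : GL (Fin 2) ℂ) : Function.Injective (glRep r g) := by
  refine Function.LeftInverse.injective (g := glRep r g⁻¹) fun p => ?_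
  simp

/-- The induced action of `GL₂(ℂ)` on `ℙ^r = ℙ S^r(ℂ²)`. -/
def glProj (r : ℕ) : GL (Fin 2) ℂ →* Function.End (ℙ ℂ (BinForm r)) where
  toFun g := Projectivization.map (glRep r g) (glRep_injective r g)
  map_one' := by
    funext p
    induction p using Projectivization.ind with
    | h v hv =>
      change Projectivization.map _ _ (Projectivization.mk ℂ v hv) = Projectivization.mk ℂ v hv
      simp [Projectivization.map_mk]
  map_mul' g h := by
    funext p
    induction p using Projectivization.ind with
    | h v hv =>
      change Projectivization.map (glRep r (g * h)) (glRep_injective r (g * h))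
          (Projectivization.mk ℂ v hv) =
        Projectivization.map (glRep r g) (glRep_injective r g)
          (Projectivization.map (glRep r h) (glRep_injective r h) (Projectivization.mk ℂ v hv))
      simp [Projectivization.map_mk]

/-- The action of `PGL₂(ℂ)` on `ℙ^r = ℙ S^r(ℂ²)`. -/
def pglProj (r : ℕ) : PGL(2, ℂ) →* Function.End (ℙ ℂ (BinForm r)) :=
  Matrix.ProjGenLinGroup.lift (glProj r) <| by
    ext u
    funext p
    induction p using Projectivization.ind with
    | h v hv =>
      change Projectivization.map (glRep r (Matrix.GeneralLinearGroup.scalar (Fin 2) u))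
        (glRep_injective r _) (Projectivization.mk ℂ v hv) = Projectivization.mk ℂ v hv
      rw [Projectivization.map_mk, Projectivization.mk_eq_mk_iff']
      exact ⟨(u : ℂ) ^ r, (symPow_scalar r u v).symm⟩

/-- A subset of `ℙ^r` stable under `PGL₂(ℂ)`. -/
def IsPGLInvariant {r : ℕ} (Z : Set (ℙ ℂ (BinForm r))) : Prop :=
  ∀ g : PGL(2, ℂ), ∀ p ∈ Z, pglProj r g p ∈ Z

/-! ### The Lie algebra action and the weight bases -/

lemma deriv_homogeneous (A : Matrix (Fin 2) (Fin 2) ℂ) {r : ℕ} (p : BinForm r) :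
    (mkDerivation ℂ (linForm A) p.1).IsHomogeneous r := by
  rw [p.1.as_sum, map_sum]
  refine IsHomogeneous.sum _ _ _ fun d hd => ?_
  rw [mkDerivation_monomial, smul_eq_C_mul, Finsupp.sum]
  refine IsHomogeneous.C_mul (IsHomogeneous.sum _ _ _ fun i hi => ?_) _
  have hdeg : d.degree = r := by
    rw [Finsupp.degree_eq_weight_one]; exact p.2 (mem_support_iff.mp hd)
  have hi' : Finsupp.single i 1 ≤ d := by
    rw [Finsupp.single_le_iff]; exact Nat.one_le_iff_ne_zero.mpr (Finsupp.mem_support_iff.mp hi)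
  have h1 : (d - Finsupp.single i 1).degree + 1 = r := by
    conv_rhs => rw [← hdeg, ← tsub_add_cancel_of_le hi']
    simp
  rw [smul_eq_mul, ← h1]
  exact (isHomogeneous_monomial _ rfl).mul (linForm_homogeneous A i)

/-- The action of `A ∈ 𝔤𝔩₂(ℂ)` on `S^r(ℂ²)`, by the derivation extending `e_j ↦ A e_j`. -/
def lieAct (r : ℕ) (A : Matrix (Fin 2) (Fin 2) ℂ) : BinForm r →ₗ[ℂ] BinForm r where
  toFun p := ⟨mkDerivation ℂ (linForm A) p.1, deriv_homogeneous A p⟩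
  map_add' p q := Subtype.ext (by simp)
  map_smul' c p := Subtype.ext (by simp)

/-- The maximal weight vector `x₀ = e₀^r`. -/
def maxWeightVec (r : ℕ) : BinForm r := ⟨X 0 ^ r, isHomogeneous_X_pow 0 r⟩

/-- The weight vectors `x_i = Y^i x₀ / i!` with `Y = (0 0; 1 0)`. -/
def weightVec (r i : ℕ) : BinForm r :=
  (i ! : ℂ)⁻¹ • (lieAct r !![0, 0; 1, 0] ^ i) (maxWeightVec r)

lemma weightVec_val (r i : ℕ) :
    (weightVec r i).1 = (r.choose i : ℂ) • (X 0 ^ (r - i) * X 1 ^ i) := by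
  have key : ∀ i : ℕ, ((lieAct r !![0, 0; 1, 0] ^ i) (maxWeightVec r)).1 =
      (r.descFactorial i : ℂ) • (X 0 ^ (r - i) * X 1 ^ i) := by
    intro i
    induction i with
    | zero => simp [maxWeightVec]
    | succ i ih =>
      rw [pow_succ', Module.End.mul_apply]
      change mkDerivation ℂ (linForm !![0, 0; 1, 0]) (Subtype.val _) = _
      rw [ih, Derivation.map_smul, Derivation.leibniz, Derivation.leibniz_pow, Derivation.leibniz_pow,
        mkDerivation_X, mkDerivation_X, Nat.descFactorial_succ, Nat.sub_sub]
      simp only [linForm, Fin.sum_univ_two]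
      simp [smul_eq_C_mul]
      ring
  change (i ! : ℂ)⁻¹ • ((lieAct r !![0, 0; 1, 0] ^ i) (maxWeightVec r)).1 = _
  rw [key, smul_smul, Nat.descFactorial_eq_factorial_mul_choose]
  congr 1
  push_cast
  rw [inv_mul_cancel_left₀ (by exact_mod_cast Nat.factorial_ne_zero i)]

/-- The coefficient of `e₀^(r-i) e₁^i`. -/
def coord (r i : ℕ) : BinForm r →ₗ[ℂ] ℂ :=
  lcoeff ℂ (Finsupp.single 0 (r - i) + Finsupp.single 1 i) ∘ₗ Submodule.subtype _

lemma coord_weightVec (r i j : ℕ) :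
    coord r i (weightVec r j) = if i = j then (r.choose i : ℂ) else 0 := by
  change coeff _ (weightVec r j).1 = _
  rw [weightVec_val, coeff_smul, X_pow_eq_monomial, X_pow_eq_monomial, monomial_mul,
    coeff_monomial]
  have : (Finsupp.single (0 : Fin 2) (r - j) + Finsupp.single 1 j =
      Finsupp.single 0 (r - i) + Finsupp.single 1 i) ↔ i = j := by
    constructor
    · intro h
      have := DFunLike.congr_fun h 1
      simpa using this.symm
    · rintro rfl; rfl
  simp only [this]
  split_ifs with h
  · simp [h]
  · simp

lemma eq_zero_of_coord {r : ℕ} (v : BinForm r) (h : ∀ i ≤ r, coord r i v = 0) : v = 0 := by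
  apply Subtype.ext
  ext d
  by_contra hd
  have hdeg : d 0 + d 1 = r := by
    have := v.2 hd
    simpa [Finsupp.weight_apply, Finsupp.sum_fintype, Fin.sum_univ_two] using this
  have h1 := h (d 1) (by omega)
  have hd' : Finsupp.single 0 (r - d 1) + Finsupp.single 1 (d 1) = d := by
    ext j; fin_cases j
    · simp; omega
    · simp
  change coeff _ v.1 = 0 at h1
  rw [hd'] at h1
  exact hd h1

lemma weightVec_linearIndependent (r : ℕ) :
    LinearIndependent ℂ (fun i : Fin (r + 1) => weightVec r i) := by
  rw [Fintype.linearIndependent_iff]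
  intro g hg i
  have h := congrArg (coord r i) hg
  have hi : ∀ j : Fin (r + 1), (j : ℕ) ≤ r := fun j => Nat.lt_succ_iff.mp j.2
  simp only [map_sum, map_smul, coord_weightVec, map_zero, Fin.val_inj] at h
  simpa [(Nat.choose_pos (hi i)).ne'] using h

lemma weightVec_span (r : ℕ) :
    ⊤ ≤ Submodule.span ℂ (Set.range (fun i : Fin (r + 1) => weightVec r i)) := by
  intro v _
  have hi : ∀ j : Fin (r + 1), (j : ℕ) ≤ r := fun j => Nat.lt_succ_iff.mp j.2
  have hv : v = ∑ i : Fin (r + 1), ((r.choose i : ℂ)⁻¹ * coord r i v) • weightVec r i := by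
    rw [← sub_eq_zero]
    refine eq_zero_of_coord _ fun k hk => ?_
    have : ∀ i : Fin (r + 1), k = (i : ℕ) ↔ (⟨k, Nat.lt_succ_iff.mpr hk⟩ : Fin (r + 1)) = i :=
      fun i => by rw [Fin.ext_iff]
    simp only [map_sub, map_sum, map_smul, coord_weightVec, this]
    have hc : (r.choose k : ℂ) ≠ 0 := by exact_mod_cast (Nat.choose_pos hk).ne'
    simp
    field_simp
    simp
  rw [hv]
  exact Submodule.sum_mem _ fun i _ =>
    Submodule.smul_mem _ _ (Submodule.subset_span (Set.mem_range_self i))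

/-- The basis `x₀, …, x_r` of `S^r(ℂ²)`. -/
def weightBasis (r : ℕ) : Module.Basis (Fin (r + 1)) ℂ (BinForm r) :=
  Module.Basis.mk (weightVec_linearIndependent r) (weightVec_span r)

/-! ### The varieties `M_m` -/

/-- A nonzero `𝔰𝔩₂(ℂ)`-linear map `f : S²(S^r(ℂ²)) → S^n(ℂ²)`, given as a symmetric bilinear map.
Since `S^n(ℂ²)` is simple and occurs at most once in `S²(S^r(ℂ²))`, this is the projection onto
that summand, up to a nonzero scalar. -/
structure IsProjection {r n : ℕ} (f : BinForm r →ₗ[ℂ] BinForm r →ₗ[ℂ] BinForm n) : Prop where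
  ne_zero : f ≠ 0
  symm : ∀ v w, f v w = f w v
  equivariant : ∀ A : LieAlgebra.SpecialLinear.sl (Fin 2) ℂ, ∀ v w,
    lieAct n A.1 (f v w) = f (lieAct r A.1 v) w + f v (lieAct r A.1 w)

/-- `{x ∈ ℙ S^r(ℂ²) | f(xx) = 0}`; this is `M_m` for the projection `f` onto `S^{2r-4m}(ℂ²)`. -/
def variety {r n : ℕ} (f : BinForm r →ₗ[ℂ] BinForm r →ₗ[ℂ] BinForm n) : Set (ℙ ℂ (BinForm r)) :=
  {p | f p.rep p.rep = 0}

/-- The zero locus in `ℙ^r` of a quadratic form. -/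
def zeroLocus {r : ℕ} (Q : QuadraticForm ℂ (BinForm r)) : Set (ℙ ℂ (BinForm r)) :=
  {p | Q p.rep = 0}

/-- A quadric in `ℙ^r`. -/
def IsQuadric {r : ℕ} (Z : Set (ℙ ℂ (BinForm r))) : Prop :=
  ∃ Q : QuadraticForm ℂ (BinForm r), Q ≠ 0 ∧ Z = zeroLocus Q

/-! ### Zariski topology and osculating varieties of the Veronese curve -/

/-- The Zariski topology on `ℙ^r`, generated by the sets `F ≠ 0` with `F` a homogeneous polynomial
in the coordinates `a₀, …, a_r` with respect to `x₀, …, x_r`. -/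
instance zariskiTopology (r : ℕ) : TopologicalSpace (ℙ ℂ (BinForm r)) :=
  TopologicalSpace.generateFrom
    {U | ∃ (d : ℕ) (F : MvPolynomial (Fin (r + 1)) ℂ), F.IsHomogeneous d ∧
      U = {p | eval ((weightBasis r).equivFun p.rep) F ≠ 0}}

/-- The `k`-th derivative at `t` of the curve `t ↦ (1, t, t², …, t^r)`, in the coordinates
with respect to `x₀, …, x_r`. -/
def curveDeriv (r k : ℕ) (t : ℂ) : BinForm r :=
  (weightBasis r).equivFun.symm fun i => iteratedDeriv k (fun s : ℂ => s ^ (i : ℕ)) t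

/-- The Veronese curve `c_r`: the closure of the points `(1 : t : t² : … : t^r)`. -/
def veroneseCurve (r : ℕ) : Set (ℙ ℂ (BinForm r)) :=
  closure {P | ∃ (t : ℂ) (h : curveDeriv r 0 t ≠ 0), P = Projectivization.mk ℂ _ h}

/-- The `p`-osculating variety `T^p c_r`: the closure of the points
`c_r(t) + l₁ c_r'(t) + … + l_p c_r^{(p)}(t)`. -/
def osculatingVariety (r p : ℕ) : Set (ℙ ℂ (BinForm r)) :=
  closure {P | ∃ (t : ℂ) (l : Fin p → ℂ)
    (h : curveDeriv r 0 t + ∑ j : Fin p, l j • curveDeriv r (j + 1) t ≠ 0),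
    P = Projectivization.mk ℂ _ h}

end BinaryForms

end

noncomputable section

namespace BinaryForms

open MvPolynomial

/-! Since `S^0` is the trivial representation, an equivariant map into it is an invariant bilinear
form times a fixed vector. Invariance under the diagonal element kills every entry off the
antidiagonal, and invariance under `Y` is a two-term recursion along it, so the form is a multiple
of `invForm` (`IsLieInvariant.eq_smul`). On pure powers this form is the `r`-th power of the
determinant (`invForm_power`). Powers span, so `symPow r A` scales it by `A.det ^ r` and its zero
locus is invariant.

Uniqueness rests on `exists_smul_eq_of_zeros`: complex quadratic forms with the same zeros are
proportional. An invariant quadric therefore has a semi-invariant equation, and a diagonal matrix,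
the swap and the unipotent matrices suffice to determine it on pairs of powers.

Irreducibility comes from joining any two points of the quadric by a rational curve inside it, the
image of a line under inverse stereographic projection. The upper bound for the dimension turns
chains of irreducible closed sets into chains of primes in `r + 1` variables; the lower bound uses a
coordinate flag in the chart `a₀ = 1`, where the equation of the quadric is solved for the last
coordinate.

Unipotent matrices carry the osculating spaces at `t = 0` to those at every `t`, and at `0` the span
of `x₀, …, x_p` is isotropic for `2p < r`. The inclusion is strict because `p + 1` parameters cannot
fill the `r - 1` free coordinates of the chart. For `r = 2` the curve contains the dense open part
`a₀ ≠ 0` of the conic. -/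

/-! ### The action of `𝔰𝔩₂` on the weight vectors -/

lemma weightBasis_apply (r : ℕ) (i : Fin (r + 1)) : weightBasis r i = weightVec r i :=
  Module.Basis.mk_apply _ _ _

/-- Lets the formulas below hold for all natural indices, without boundary cases at `i = r`. -/
lemma weightVec_eq_zero {r i : ℕ} (h : r < i) : weightVec r i = 0 := by
  apply Subtype.ext
  rw [weightVec_val, Nat.choose_eq_zero_of_lt h]
  simp

lemma lieAct_lower_weightVec (r i : ℕ) :
    lieAct r !![0, 0; 1, 0] (weightVec r i) = ((i : ℂ) + 1) • weightVec r (i + 1) := by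
  rw [weightVec, weightVec, map_smul, ← Module.End.mul_apply, ← pow_succ', smul_smul]
  congr 1
  rw [Nat.factorial_succ]
  have h1 : (i ! : ℂ) ≠ 0 := by exact_mod_cast i.factorial_ne_zero
  have h2 : (i : ℂ) + 1 ≠ 0 := by exact_mod_cast i.succ_ne_zero
  push_cast
  field_simp

lemma lieAct_diag_weightVec (r i : ℕ) :
    lieAct r !![1, 0; 0, -1] (weightVec r i) = ((r : ℂ) - 2 * i) • weightVec r i := by
  rcases lt_or_ge r i with h | h
  · simp [weightVec_eq_zero h]
  obtain ⟨k, rfl⟩ := Nat.exists_eq_add_of_le h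
  apply Subtype.ext
  change mkDerivation ℂ (linForm !![1, 0; 0, -1]) (weightVec (i + k) i).1 =
    (((i + k : ℕ) : ℂ) - 2 * i) • (weightVec (i + k) i).1
  rw [weightVec_val, Derivation.map_smul, smul_comm, Derivation.leibniz, Derivation.leibniz_pow,
    Derivation.leibniz_pow, mkDerivation_X, mkDerivation_X]
  congr 1
  rw [Nat.add_sub_cancel_left]
  rcases i with _ | i <;> rcases k with _ | k <;>
  · simp [linForm, Fin.sum_univ_two, smul_eq_C_mul, map_ofNat]
    try first | ring1 | (left; ring1)

lemma lieAct_raise_weightVec_zero (r : ℕ) : lieAct r !![0, 1; 0, 0] (weightVec r 0) = 0 := by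
  apply Subtype.ext
  change mkDerivation ℂ (linForm !![0, 1; 0, 0]) (weightVec r 0).1 = 0
  rw [weightVec_val, Derivation.map_smul, Derivation.leibniz, Derivation.leibniz_pow,
    Derivation.leibniz_pow, mkDerivation_X, mkDerivation_X]
  simp [linForm, Fin.sum_univ_two]

lemma lieAct_raise_weightVec_succ (r i : ℕ) :
    lieAct r !![0, 1; 0, 0] (weightVec r (i + 1)) = ((r : ℂ) - i) • weightVec r i := by
  rcases lt_or_ge r i with h | h
  · simp [weightVec_eq_zero h, weightVec_eq_zero (h.trans i.lt_succ_self)]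
  rcases h.eq_or_lt with rfl | h
  · simp [weightVec_eq_zero i.lt_succ_self]
  obtain ⟨k, rfl⟩ := Nat.exists_eq_add_of_le h
  apply Subtype.ext
  change mkDerivation ℂ (linForm !![0, 1; 0, 0]) (weightVec (i + 1 + k) (i + 1)).1 =
    (((i + 1 + k : ℕ) : ℂ) - i) • (weightVec (i + 1 + k) i).1
  rw [weightVec_val, weightVec_val, Derivation.map_smul, Derivation.leibniz, Derivation.leibniz_pow,
    Derivation.leibniz_pow, mkDerivation_X, mkDerivation_X, Nat.add_sub_cancel_left,
    show i + 1 + k - i = k + 1 by omega]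
  have hc : (((i + 1 + k).choose (i + 1) : ℕ) : ℂ) * (i + 1) =
      ((i + 1 + k).choose i : ℕ) * (k + 1) := by
    have := Nat.choose_succ_right_eq (i + 1 + k) i
    rw [show i + 1 + k - i = k + 1 by omega] at this
    exact_mod_cast this
  have hC := congrArg (C : ℂ → MvPolynomial (Fin 2) ℂ) hc
  simp only [map_mul, map_add, map_one, map_natCast] at hC
  simp [linForm, Fin.sum_univ_two, smul_eq_C_mul]
  linear_combination (X 0 ^ k * X 0 * X 1 ^ i) * hC

/-- A derivation is determined by its values on the two variables. This reduces invariance under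
`𝔰𝔩₂` to its three standard generators. -/
lemma lieAct_eq (r : ℕ) (A : Matrix (Fin 2) (Fin 2) ℂ) (hA : A.trace = 0) (v : BinForm r) :
    lieAct r A v = A 0 0 • lieAct r !![1, 0; 0, -1] v + A 0 1 • lieAct r !![0, 1; 0, 0] v +
      A 1 0 • lieAct r !![0, 0; 1, 0] v := by
  have h : A 1 1 = - A 0 0 := by
    rw [Matrix.trace_fin_two] at hA; linear_combination hA
  apply Subtype.ext
  change mkDerivation ℂ (linForm A) v.1 =
    (A 0 0 • mkDerivation ℂ (linForm !![1, 0; 0, -1]) + A 0 1 • mkDerivation ℂ (linForm !![0, 1; 0, 0])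
      + A 1 0 • mkDerivation ℂ (linForm !![0, 0; 1, 0])) v.1
  congr 1
  apply MvPolynomial.derivation_ext
  intro j
  fin_cases j
  · simp [linForm, Fin.sum_univ_two]
  · simp [linForm, Fin.sum_univ_two, h]
    ring

/-! ### The invariant bilinear form and its uniqueness -/

/-- The form `x_i, x_j ↦ (-1)^i (r choose i)` if `i + j = r` and `0` otherwise. -/
def invForm (r : ℕ) : LinearMap.BilinForm ℂ (BinForm r) :=
  Matrix.toBilin (weightBasis r) (Matrix.of fun i j : Fin (r + 1) =>
    if (i : ℕ) + (j : ℕ) = r then (-1) ^ (i : ℕ) * (r.choose i : ℂ) else 0)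

lemma toMatrix_invForm (r : ℕ) :
    LinearMap.BilinForm.toMatrix (weightBasis r) (invForm r) = Matrix.of fun i j : Fin (r + 1) =>
      if (i : ℕ) + (j : ℕ) = r then (-1) ^ (i : ℕ) * (r.choose i : ℂ) else 0 :=
  LinearMap.BilinForm.toMatrix_toBilin _ _

lemma invForm_weightVec (r i j : ℕ) : invForm r (weightVec r i) (weightVec r j) =
    if i + j = r then (-1) ^ i * (r.choose i : ℂ) else 0 := by
  rcases lt_or_ge r i with hi | hi
  · rw [weightVec_eq_zero hi]; simp; omega
  rcases lt_or_ge r j with hj | hj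
  · rw [weightVec_eq_zero hj]; simp; omega
  have := congrFun₂ (toMatrix_invForm r) ⟨i, by omega⟩ ⟨j, by omega⟩
  rwa [LinearMap.BilinForm.toMatrix_apply, weightBasis_apply, weightBasis_apply] at this

lemma bilin_ext {r : ℕ} {B B' : LinearMap.BilinForm ℂ (BinForm r)}
    (h : ∀ i ≤ r, ∀ j ≤ r, B (weightVec r i) (weightVec r j) = B' (weightVec r i) (weightVec r j)) :
    B = B' := by
  refine LinearMap.BilinForm.ext_basis (weightBasis r) fun i j => ?_
  rw [weightBasis_apply, weightBasis_apply]
  exact h _ (Nat.lt_succ_iff.mp i.2) _ (Nat.lt_succ_iff.mp j.2)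

lemma invForm_symm {r : ℕ} (hr : Even r) (v w : BinForm r) : invForm r v w = invForm r w v := by
  have h : invForm r = LinearMap.BilinForm.flip (invForm r) := by
    refine bilin_ext fun i hi j hj => ?_
    rw [LinearMap.BilinForm.flip_apply, invForm_weightVec, invForm_weightVec, add_comm j i]
    split_ifs with h
    · subst h
      rw [Nat.choose_symm_add]
      congr 1
      rcases Nat.even_or_odd i with hi' | hi'
      · rw [hi'.neg_one_pow, ((Nat.even_add.mp hr).mp hi').neg_one_pow]
      · rw [hi'.neg_one_pow, Odd.neg_one_pow]
        rw [← Nat.not_even_iff_odd] at hi' ⊢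
        rwa [← Nat.even_add.mp hr]
    · rfl
  conv_lhs => rw [h]
  rfl

lemma eq_sum_weightVec {r : ℕ} (v : BinForm r) :
    v = ∑ i : Fin (r + 1), (weightBasis r).equivFun v i • weightVec r i := by
  conv_lhs => rw [← (weightBasis r).sum_equivFun v]
  simp only [weightBasis_apply]

lemma invForm_apply_weightVec {r i : ℕ} (hi : i ≤ r) (v : BinForm r) :
    invForm r v (weightVec r (r - i)) =
      (-1) ^ i * (r.choose i : ℂ) * (weightBasis r).equivFun v ⟨i, by omega⟩ := by
  conv_lhs => rw [eq_sum_weightVec v]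
  rw [map_sum, LinearMap.sum_apply, Finset.sum_eq_single ⟨i, by omega⟩]
  · rw [map_smul, LinearMap.smul_apply, invForm_weightVec, if_pos (by simp; omega), smul_eq_mul]
    ring
  · intro j _ hj
    rw [map_smul, LinearMap.smul_apply, invForm_weightVec, if_neg, smul_zero]
    intro h
    apply hj
    ext
    simp
    omega
  · simp

lemma eq_zero_of_invForm {r : ℕ} {v : BinForm r} (h : ∀ w, invForm r v w = 0) : v = 0 := by
  apply (weightBasis r).equivFun.injective
  ext i
  have hi : (i : ℕ) ≤ r := Nat.lt_succ_iff.mp i.2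
  have := invForm_apply_weightVec hi v
  rw [h] at this
  have hc : (r.choose i : ℂ) ≠ 0 := by exact_mod_cast (Nat.choose_pos hi).ne'
  simpa [hc] using this.symm

/-- A bilinear form annihilated by `Y` and vanishing outside the antidiagonal. -/
lemma eq_smul_invForm {r : ℕ} (B : LinearMap.BilinForm ℂ (BinForm r))
    (hdiag : ∀ i j, i + j ≠ r → B (weightVec r i) (weightVec r j) = 0)
    (hlow : ∀ i j, i + j + 1 = r → ((i : ℂ) + 1) * B (weightVec r (i + 1)) (weightVec r j) +
      ((j : ℂ) + 1) * B (weightVec r i) (weightVec r (j + 1)) = 0) :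
    B = B (weightVec r 0) (weightVec r r) • invForm r := by
  refine bilin_ext fun i hi j hj => ?_
  rw [LinearMap.smul_apply, LinearMap.smul_apply, invForm_weightVec]
  split_ifs with h
  -- Moving along the antidiagonal, the relation for `Y` matches the binomial recursion `(i + 1) (r
  -- choose i + 1) = (r - i) (r choose i)`, up to the alternating sign.
  · induction i generalizing j with
    | zero => obtain rfl : j = r := by omega
              simp
    | succ i ih =>
      have h1 := ih (by omega) (j + 1) (by omega) (by omega)
      have h2 := hlow i j (by omega)
      rw [h1] at h2
      have hc : ((r.choose (i + 1) : ℕ) : ℂ) * (i + 1) = (r.choose i : ℕ) * (j + 1) := by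
        have := Nat.choose_succ_right_eq r i
        rw [show r - i = j + 1 by omega] at this
        exact_mod_cast this
      have h3 : (i : ℂ) + 1 ≠ 0 := by exact_mod_cast i.succ_ne_zero
      apply mul_left_cancel₀ h3
      simp only [smul_eq_mul] at h2 ⊢
      rw [pow_succ]
      linear_combination h2 + B (weightVec r 0) (weightVec r r) * (-1) ^ i * hc
  · simpa using hdiag i j h

/-- Invariance of a bilinear form under `𝔰𝔩₂(ℂ)`. -/
def IsLieInvariant {r : ℕ} (B : LinearMap.BilinForm ℂ (BinForm r)) : Prop :=
  ∀ A : LieAlgebra.SpecialLinear.sl (Fin 2) ℂ, ∀ v w,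
    B (lieAct r A.1 v) w + B v (lieAct r A.1 w) = 0

/-- On weight vectors, the diagonal generator acts by opposite weights whenever `i + j = r`, and for
the raising and lowering generators the two terms cancel by the same binomial recursion. -/
lemma invForm_isLieInvariant (r : ℕ) : IsLieInvariant (invForm r) := by
  rintro ⟨A, hA⟩
  replace hA : A.trace = 0 := by simpa [LieAlgebra.SpecialLinear.sl] using hA
  have key : ∀ D : BinForm r →ₗ[ℂ] BinForm r,
      (∀ i ≤ r, ∀ j ≤ r, invForm r (D (weightVec r i)) (weightVec r j) +
        invForm r (weightVec r i) (D (weightVec r j)) = 0) →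
      ∀ v w, invForm r (D v) w + invForm r v (D w) = 0 := by
    intro D hD v w
    have : (invForm r).comp D LinearMap.id + (invForm r).comp LinearMap.id D = 0 :=
      bilin_ext fun i hi j hj => by simpa using hD i hi j hj
    simpa using LinearMap.congr_fun₂ this v w
  intro v w
  have hH := key (lieAct r !![1, 0; 0, -1]) (fun i _ j _ => by
    rw [lieAct_diag_weightVec, lieAct_diag_weightVec]
    simp only [map_smul, LinearMap.smul_apply, invForm_weightVec]
    split_ifs with h
    · subst h
      simp only [smul_eq_mul]
      push_cast
      ring
    · simp) v w
  have hY := key (lieAct r !![0, 0; 1, 0]) (fun i _ j _ => by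
    rw [lieAct_lower_weightVec, lieAct_lower_weightVec]
    simp only [map_smul, LinearMap.smul_apply, invForm_weightVec, show i + 1 + j = i + j + 1 by ring,
      ← add_assoc]
    split_ifs with h
    · have hc : ((r.choose (i + 1) : ℕ) : ℂ) * (i + 1) = (r.choose i : ℕ) * (j + 1) := by
        have := Nat.choose_succ_right_eq r i
        rw [show r - i = j + 1 by omega] at this
        exact_mod_cast this
      simp only [smul_eq_mul]
      linear_combination (-1) ^ (i + 1) * hc
    · simp) v w
  have hX := key (lieAct r !![0, 1; 0, 0]) (fun i _ j _ => by
    rcases i with _ | i <;> rcases j with _ | j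
    · simp [lieAct_raise_weightVec_zero]
    · rw [lieAct_raise_weightVec_zero, lieAct_raise_weightVec_succ]
      simp only [map_smul, map_zero, LinearMap.zero_apply, invForm_weightVec]
      split_ifs with h
      · rw [← h]; simp
      · simp
    · rw [lieAct_raise_weightVec_zero, lieAct_raise_weightVec_succ]
      simp only [map_smul, map_zero, LinearMap.smul_apply, invForm_weightVec]
      split_ifs with h
      · rw [← h]; simp
      · simp
    · rw [lieAct_raise_weightVec_succ, lieAct_raise_weightVec_succ]
      simp only [map_smul, LinearMap.smul_apply, invForm_weightVec, show i + 1 + j = i + j + 1 by ring,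
        ← add_assoc]
      split_ifs with h
      · have hc : ((r.choose (i + 1) : ℕ) : ℂ) * (i + 1) = (r.choose i : ℕ) * (j + 1) := by
          have := Nat.choose_succ_right_eq r i
          rw [show r - i = j + 1 by omega] at this
          exact_mod_cast this
        have hr : (r : ℂ) = i + j + 1 := by rw [← h]; push_cast; ring
        simp only [smul_eq_mul]
        rw [hr]
        linear_combination (-1) ^ (i + 1) * hc
      · simp) v w
  change invForm r (lieAct r A v) w + invForm r v (lieAct r A w) = 0
  rw [lieAct_eq r A hA v, lieAct_eq r A hA w]
  simp only [map_add, map_smul, LinearMap.add_apply, LinearMap.smul_apply, smul_eq_mul]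
  linear_combination A 0 0 * hH + A 0 1 * hX + A 1 0 * hY

lemma IsLieInvariant.eq_smul {r : ℕ} {B : LinearMap.BilinForm ℂ (BinForm r)}
    (hB : IsLieInvariant B) : B = B (weightVec r 0) (weightVec r r) • invForm r := by
  refine eq_smul_invForm B (fun i j hij => ?_) (fun i j _ => ?_)
  · have := hB ⟨!![1, 0; 0, -1], by
      simp [LieAlgebra.SpecialLinear.sl]⟩ (weightVec r i) (weightVec r j)
    simp only [lieAct_diag_weightVec, map_smul, LinearMap.smul_apply, smul_eq_mul] at this
    rw [← add_mul, mul_eq_zero] at this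
    -- The sum of the two weights is `2r - 2(i + j)`, which vanishes only on the antidiagonal.
    refine this.resolve_left fun h => hij ?_
    have h' : ((i + j : ℕ) : ℂ) = (r : ℕ) := by push_cast; linear_combination - h / 2
    exact_mod_cast h'
  · have := hB ⟨!![0, 0; 1, 0], by
      simp [LieAlgebra.SpecialLinear.sl]⟩ (weightVec r i) (weightVec r j)
    simpa only [lieAct_lower_weightVec, map_smul, LinearMap.smul_apply, smul_eq_mul] using this

/-- Derivations kill constants; this turns equivariance into invariance of a scalar form. -/
lemma lieAct_zero (A : Matrix (Fin 2) (Fin 2) ℂ) (v : BinForm 0) : lieAct 0 A v = 0 := by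
  apply Subtype.ext
  have hv : v.1 = C (coeff 0 v.1) := by
    have := v.2
    rw [mem_homogeneousSubmodule] at this
    exact totalDegree_eq_zero_iff_eq_C.mp (Nat.le_zero.mp this.totalDegree_le)
  change mkDerivation ℂ (linForm A) v.1 = 0
  rw [hv]
  exact derivation_C _ _

lemma eq_coord_smul_zero (v : BinForm 0) : v = coord 0 0 v • weightVec 0 0 := by
  rw [← sub_eq_zero]
  refine eq_zero_of_coord _ fun i hi => ?_
  obtain rfl : i = 0 := by omega
  simp [coord_weightVec]

lemma exists_isProjection_zero {r : ℕ} (hr : Even r) :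
    ∃ f : BinForm r →ₗ[ℂ] BinForm r →ₗ[ℂ] BinForm 0, IsProjection f := by
  refine ⟨(invForm r).compr₂ (LinearMap.toSpanSingleton ℂ _ (weightVec 0 0)), ?_, ?_, ?_⟩
  · intro h
    have := congrArg (coord 0 0) (LinearMap.congr_fun₂ h (weightVec r 0) (weightVec r r))
    simp [invForm_weightVec, coord_weightVec] at this
  · intro v w
    simp [invForm_symm hr v w]
  · intro A v w
    rw [lieAct_zero]
    simp [← add_smul, invForm_isLieInvariant r A v w]

lemma IsProjection.exists_eq_smul {r : ℕ} {f : BinForm r →ₗ[ℂ] BinForm r →ₗ[ℂ] BinForm 0}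
    (hf : IsProjection f) :
    ∃ lam : ℂ, lam ≠ 0 ∧ ∀ v w, f v w = (lam • invForm r) v w • weightVec 0 0 := by
  have h : IsLieInvariant (f.compr₂ (coord 0 0)) := fun A v w => by
    have := hf.equivariant A v w
    rw [lieAct_zero] at this
    simpa using (congrArg (coord 0 0) this).symm
  have hfc : ∀ v w, f v w = (f.compr₂ (coord 0 0)) v w • weightVec 0 0 :=
    fun v w => eq_coord_smul_zero _
  rw [h.eq_smul] at hfc
  refine ⟨_, fun h0 => hf.ne_zero ?_, hfc⟩
  rw [h0] at hfc
  ext1 v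
  ext1 w
  rw [hfc]
  simp

/-! ### Pure powers and the `GL₂` action on the form -/

/-- The power `(a e₀ + b e₁)^r`. -/
def power (r : ℕ) (a b : ℂ) : BinForm r :=
  ∑ i : Fin (r + 1), (a ^ (r - (i : ℕ)) * b ^ (i : ℕ)) • weightVec r i

lemma power_val (r : ℕ) (a b : ℂ) : (power r a b).1 = (C a * X 0 + C b * X 1) ^ r := by
  rw [add_comm, add_pow, Finset.sum_range, power, AddSubmonoidClass.coe_finsetSum]
  refine Finset.sum_congr rfl fun i _ => ?_
  change (a ^ (r - (i : ℕ)) * b ^ (i : ℕ)) • (weightVec r i).1 = _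
  rw [weightVec_val]
  simp only [smul_eq_C_mul, map_mul, map_pow, mul_pow, map_natCast]
  ring

lemma equivFun_power (r : ℕ) (a b : ℂ) (i : Fin (r + 1)) :
    (weightBasis r).equivFun (power r a b) i = a ^ (r - (i : ℕ)) * b ^ (i : ℕ) := by
  have : power r a b = (weightBasis r).equivFun.symm fun i => a ^ (r - (i : ℕ)) * b ^ (i : ℕ) := by
    rw [Module.Basis.equivFun_symm_apply]
    simp only [weightBasis_apply, power]
  rw [this, LinearEquiv.apply_symm_apply]

lemma symPow_power (r : ℕ) (A : Matrix (Fin 2) (Fin 2) ℂ) (a b : ℂ) :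
    symPow r A (power r a b) = power r (A 0 0 * a + A 0 1 * b) (A 1 0 * a + A 1 1 * b) := by
  apply Subtype.ext
  change aeval (linForm A) (power r a b).1 = _
  rw [power_val, power_val]
  simp only [map_pow, map_add, map_mul, aeval_X, aeval_C, algebraMap_eq, linForm, Fin.sum_univ_two,
    smul_eq_C_mul]
  congr 1
  ring

lemma invForm_apply {r : ℕ} (v w : BinForm r) : invForm r v w = ∑ i : Fin (r + 1),
    (-1) ^ (i : ℕ) * (r.choose i : ℂ) * (weightBasis r).equivFun v i *
      (weightBasis r).equivFun w i.rev := by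
  conv_lhs => rw [eq_sum_weightVec w]
  rw [map_sum, ← Equiv.sum_comp Fin.revPerm]
  refine Finset.sum_congr rfl fun i _ => ?_
  have hi : (i : ℕ) ≤ r := Nat.lt_succ_iff.mp i.2
  have hrev : ((Fin.revPerm i : Fin (r + 1)) : ℕ) = r - i := by
    simp [Fin.val_rev]
  rw [map_smul, hrev, invForm_apply_weightVec hi, smul_eq_mul, Fin.revPerm_apply]
  ring

/-- The binomial theorem: the signs and binomials on the antidiagonal are exactly those in the
expansion of the right-hand side. -/
lemma invForm_power (r : ℕ) (a b c d : ℂ) :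
    invForm r (power r a b) (power r c d) = (a * d - b * c) ^ r := by
  rw [invForm_apply, show a * d - b * c = -(b * c) + a * d by ring, add_pow, Finset.sum_range]
  refine Finset.sum_congr rfl fun i _ => ?_
  have hi : (i : ℕ) ≤ r := Nat.lt_succ_iff.mp i.2
  have h1 : ((i.rev : Fin (r + 1)) : ℕ) = r - i := by simp [Fin.val_rev]
  rw [equivFun_power, equivFun_power, h1, Nat.sub_sub_self hi, neg_pow (b * c), mul_pow, mul_pow]
  ring

lemma map_power {r : ℕ} (f : BinForm r →ₗ[ℂ] ℂ) (t : ℂ) :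
    f (power r 1 t) = (∑ i : Fin (r + 1),
      Polynomial.C (f (weightVec r i)) * Polynomial.X ^ (i : ℕ)).eval t := by
  rw [power, map_sum, Polynomial.eval_finsetSum]
  refine Finset.sum_congr rfl fun i _ => ?_
  simp only [map_smul, one_pow, one_mul, smul_eq_mul, Polynomial.eval_mul, Polynomial.eval_C,
    Polynomial.eval_pow, Polynomial.eval_X]
  ring

/-- Along the powers `f` is a polynomial in `t` whose coefficients are its values on the basis. In
other words, these powers span, so linear and bilinear identities can be tested on them. -/
lemma eq_zero_of_power {r : ℕ} (f : BinForm r →ₗ[ℂ] ℂ) (h : ∀ t, f (power r 1 t) = 0) : f = 0 := by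
  have h0 : (∑ i : Fin (r + 1),
      Polynomial.C (f (weightVec r i)) * Polynomial.X ^ (i : ℕ)) = 0 := by
    refine Polynomial.funext fun t => ?_
    rw [← map_power, h, Polynomial.eval_zero]
  refine (weightBasis r).ext fun i => ?_
  rw [weightBasis_apply, LinearMap.zero_apply]
  have := congrArg (fun p => Polynomial.coeff p (i : ℕ)) h0
  simpa [Polynomial.finsetSum_coeff, Polynomial.coeff_X_pow, Fin.val_inj] using this

lemma bilin_ext_power {r : ℕ} {B B' : LinearMap.BilinForm ℂ (BinForm r)}
    (h : ∀ s t, B (power r 1 s) (power r 1 t) = B' (power r 1 s) (power r 1 t)) : B = B' := by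
  have h1 : ∀ s, B (power r 1 s) = B' (power r 1 s) := fun s => by
    rw [← sub_eq_zero]
    exact eq_zero_of_power _ fun t => by simp [h s t]
  refine LinearMap.ext₂ fun v w => ?_
  have := eq_zero_of_power ((B - B').flip w) fun s => by simp [h1 s]
  have := LinearMap.congr_fun this v
  simpa [sub_eq_zero] using this

lemma invForm_symPow (r : ℕ) (A : Matrix (Fin 2) (Fin 2) ℂ) (v w : BinForm r) :
    invForm r (symPow r A v) (symPow r A w) = A.det ^ r * invForm r v w := by
  have : (invForm r).comp (symPow r A) (symPow r A) = A.det ^ r • invForm r := by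
    refine bilin_ext_power fun s t => ?_
    simp only [LinearMap.BilinForm.comp_apply, LinearMap.smul_apply, symPow_power, invForm_power,
      smul_eq_mul, Matrix.det_fin_two, ← mul_pow]
    congr 1
    ring
  simpa using LinearMap.congr_fun₂ this v w

/-! ### Quadratic forms with the same zeros -/

lemma exists_factor_quadratic {a : ℂ} (ha : a ≠ 0) (b c : ℂ) :
    ∃ t₁ t₂ : ℂ, ∀ t, a * t ^ 2 + b * t + c = a * ((t - t₁) * (t - t₂)) := by
  obtain ⟨s, hs⟩ := IsAlgClosed.exists_pow_nat_eq (b ^ 2 - 4 * a * c) two_pos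
  refine ⟨(-b + s) / (2 * a), (-b - s) / (2 * a), fun t => ?_⟩
  field_simp
  linear_combination hs

/-- Fix `v` with `Q₁ v ≠ 0`. On each line `w + t v` both forms are quadratic polynomials in `t` with
leading coefficients `Qᵢ v ≠ 0` and the same root set, hence the same product of roots, and this
product is `Qᵢ w / Qᵢ v`. -/
lemma exists_smul_eq_of_zeros {V : Type*} [AddCommGroup V] [Module ℂ V] {Q₁ Q₂ : QuadraticForm ℂ V}
    (h₁ : Q₁ ≠ 0) (h : ∀ v, Q₁ v = 0 ↔ Q₂ v = 0) : ∃ c : ℂ, c ≠ 0 ∧ Q₂ = c • Q₁ := by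
  obtain ⟨v, hv⟩ : ∃ v, Q₁ v ≠ 0 := by
    by_contra! h0
    exact h₁ (QuadraticMap.ext h0)
  have hv' : Q₂ v ≠ 0 := fun h0 => hv ((h v).mpr h0)
  refine ⟨Q₂ v / Q₁ v, div_ne_zero hv' hv, QuadraticMap.ext fun w => ?_⟩
  have expand : ∀ (Q : QuadraticForm ℂ V) (t : ℂ),
      Q (w + t • v) = Q v * t ^ 2 + QuadraticMap.polar Q w v * t + Q w := fun Q t => by
    rw [QuadraticMap.map_add Q, QuadraticMap.map_smul, QuadraticMap.polar_smul_right]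
    simp only [smul_eq_mul]
    ring
  obtain ⟨t₁, t₂, ht⟩ := exists_factor_quadratic hv (QuadraticMap.polar Q₁ w v) (Q₁ w)
  obtain ⟨u₁, u₂, hu⟩ := exists_factor_quadratic hv' (QuadraticMap.polar Q₂ w v) (Q₂ w)
  have key : ∀ t, (t = t₁ ∨ t = t₂) ↔ (t = u₁ ∨ t = u₂) := fun t => by
    have := h (w + t • v)
    rw [expand, expand, ht, hu] at this
    simpa [hv, hv', sub_eq_zero] using this
  -- Multiplicities cause no trouble: two roots on each side leave no choice, and a one-element root
  -- set means a double root on both sides.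
  have hprod : t₁ * t₂ = u₁ * u₂ := by
    have a1 := (key t₁).mp (Or.inl rfl)
    have a2 := (key t₂).mp (Or.inr rfl)
    have a3 := (key u₁).mpr (Or.inl rfl)
    have a4 := (key u₂).mpr (Or.inr rfl)
    grind
  have e1 := ht 0
  have e2 := hu 0
  simp only [_root_.smul_apply, smul_eq_mul]
  field_simp
  linear_combination Q₁ v * e2 - Q₂ v * e1 - Q₁ v * Q₂ v * hprod

/-! ### Invariant quadrics -/

lemma mk_mem_zeroLocus {r : ℕ} (Q : QuadraticForm ℂ (BinForm r)) (v : BinForm r) (hv : v ≠ 0) :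
    Projectivization.mk ℂ v hv ∈ zeroLocus Q ↔ Q v = 0 := by
  obtain ⟨a, ha⟩ := Projectivization.exists_smul_eq_mk_rep ℂ v hv
  change Q (Projectivization.mk ℂ v hv).rep = 0 ↔ _
  rw [← ha, Units.smul_def, QuadraticMap.map_smul]
  simp

lemma zeroLocus_smul {r : ℕ} (Q : QuadraticForm ℂ (BinForm r)) {c : ℂ} (hc : c ≠ 0) :
    zeroLocus (c • Q) = zeroLocus Q := by
  ext p
  simp [zeroLocus, hc]

lemma isPGLInvariant_zeroLocus_iff {r : ℕ} (Q : QuadraticForm ℂ (BinForm r)) :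
    IsPGLInvariant (zeroLocus Q) ↔ ∀ (g : GL (Fin 2) ℂ) (v : BinForm r),
      Q v = 0 → Q (glRep r g v) = 0 := by
  have hpgl : ∀ (g : GL (Fin 2) ℂ) (v : BinForm r) (hv : v ≠ 0),
      pglProj r (Matrix.ProjGenLinGroup.mk g) (Projectivization.mk ℂ v hv) =
        Projectivization.mk ℂ (glRep r g v)
          ((map_ne_zero_iff _ (glRep_injective r g)).mpr hv) := fun g v hv => rfl
  constructor
  · intro h g v hQ
    by_cases hv : v = 0
    · simp [hv]
    have := h (Matrix.ProjGenLinGroup.mk g) _ ((mk_mem_zeroLocus Q v hv).mpr hQ)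
    rwa [hpgl, mk_mem_zeroLocus] at this
  · intro h g p hp
    induction g using Matrix.ProjGenLinGroup.induction_on with
    | mk g =>
      induction p using Projectivization.ind with
      | h v hv =>
        rw [mk_mem_zeroLocus] at hp
        rw [hpgl, mk_mem_zeroLocus]
        exact h g v hp

lemma isPGLInvariant_invForm (r : ℕ) : IsPGLInvariant (zeroLocus (invForm r).toQuadraticMap) := by
  rw [isPGLInvariant_zeroLocus_iff]
  intro g v hv
  change invForm r (symPow r g.1 v) (symPow r g.1 v) = 0
  change invForm r v v = 0 at hv
  rw [invForm_symPow, hv, mul_zero]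

lemma symPow_diag_weightVec (r i : ℕ) (a : ℂ) :
    symPow r !![1, 0; 0, a] (weightVec r i) = a ^ i • weightVec r i := by
  apply Subtype.ext
  change aeval (linForm !![1, 0; 0, a]) (weightVec r i).1 = a ^ i • (weightVec r i).1
  rw [weightVec_val]
  simp [linForm, Fin.sum_univ_two, smul_eq_C_mul, mul_pow]
  ring

lemma symPow_swap_weightVec {r i : ℕ} (hi : i ≤ r) :
    symPow r !![0, 1; 1, 0] (weightVec r i) = weightVec r (r - i) := by
  apply Subtype.ext
  change aeval (linForm !![0, 1; 1, 0]) (weightVec r i).1 = (weightVec r (r - i)).1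
  rw [weightVec_val, weightVec_val, Nat.choose_symm hi, Nat.sub_sub_self hi]
  simp [linForm, Fin.sum_univ_two, mul_comm]

/-- `Q` and its pullback by `g` have the same zeros (the converse implication uses `g⁻¹`), hence are
proportional; polarization gives the bilinear statement. -/
lemma exists_semiinvariant {r : ℕ} {Q : QuadraticForm ℂ (BinForm r)} (hQ : Q ≠ 0)
    (h : IsPGLInvariant (zeroLocus Q)) (A : Matrix (Fin 2) (Fin 2) ℂ) (hA : A.det ≠ 0) :
    ∃ c : ℂ, c ≠ 0 ∧ ∀ v w, QuadraticMap.associated Q (symPow r A v) (symPow r A w) =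
      c * QuadraticMap.associated Q v w := by
  rw [isPGLInvariant_zeroLocus_iff] at h
  let g : GL (Fin 2) ℂ := Matrix.GeneralLinearGroup.mkOfDetNeZero A hA
  have hg : glRep r g = symPow r A := rfl
  obtain ⟨c, hc, hcQ⟩ := exists_smul_eq_of_zeros (Q₂ := Q.comp (glRep r g)) hQ fun v => by
    rw [QuadraticMap.comp_apply]
    refine ⟨h g v, fun hv => ?_⟩
    have := h g⁻¹ _ hv
    rwa [← Module.End.mul_apply, ← map_mul, inv_mul_cancel, map_one, Module.End.one_apply] at this
  refine ⟨c, hc, fun v w => ?_⟩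
  have := congrArg (fun q => QuadraticMap.associated q v w) hcQ
  simpa [QuadraticMap.associated_comp, hg] using this

lemma eq_smul_of_isPGLInvariant {r : ℕ} (hr : Even r) {Q : QuadraticForm ℂ (BinForm r)} (hQ : Q ≠ 0)
    (h : IsPGLInvariant (zeroLocus Q)) :
    ∃ c : ℂ, c ≠ 0 ∧ Q = c • (invForm r).toQuadraticMap := by
  set B : LinearMap.BilinForm ℂ (BinForm r) := QuadraticMap.associated Q with hB
  have hBQ : ∀ v, B v v = Q v := fun v => QuadraticMap.associated_eq_self_apply ℂ Q v
  have hB0 : B ≠ 0 := fun h0 => hQ (QuadraticMap.ext fun v => by rw [← hBQ, h0]; rfl)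
  have hsymm : ∀ v w, B v w = B w v := fun v w => QuadraticMap.associated_isSymm ℂ Q v w
  obtain ⟨i, hi, j, hj, hij⟩ : ∃ i ≤ r, ∃ j ≤ r, B (weightVec r i) (weightVec r j) ≠ 0 := by
    by_contra! h0
    exact hB0 (bilin_ext fun i hi j hj => by simpa using h0 i hi j hj)
  -- Every nonzero entry satisfies `2 ^ (k + l) = c`, so all of them lie on a single antidiagonal.
  obtain ⟨c, hc, hcB⟩ := exists_semiinvariant hQ h !![1, 0; 0, 2] (by simp)
  have hk : ∀ k l, B (weightVec r k) (weightVec r l) ≠ 0 → (2 : ℂ) ^ (k + l) = c := by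
    intro k l hkl
    have := hcB (weightVec r k) (weightVec r l)
    rw [← hB, symPow_diag_weightVec, symPow_diag_weightVec] at this
    simp only [map_smul, LinearMap.smul_apply, smul_eq_mul, ← mul_assoc] at this
    rw [← mul_right_cancel₀ hkl this]
    ring
  have hk' : ∀ k l k' l', B (weightVec r k) (weightVec r l) ≠ 0 →
      B (weightVec r k') (weightVec r l') ≠ 0 → k + l = k' + l' := by
    intro k l k' l' h1 h2
    have := (hk k l h1).trans (hk k' l' h2).symm
    exact Nat.pow_right_injective le_rfl (by exact_mod_cast this)
  -- The swap sends the antidiagonal of sum `i + j` to that of sum `2r - (i + j)`, so the common sum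
  -- is `r`.
  obtain ⟨d, hd, hdB⟩ := exists_semiinvariant hQ h !![0, 1; 1, 0] (by simp)
  have hsum : i + j = r := by
    have h1 := hdB (weightVec r i) (weightVec r j)
    rw [← hB, symPow_swap_weightVec hi, symPow_swap_weightVec hj] at h1
    have := hk' i j (r - i) (r - j) hij (by rw [h1]; exact mul_ne_zero hd hij)
    omega
  have hanti : ∀ k l, k + l ≠ r → B (weightVec r k) (weightVec r l) = 0 := by
    intro k l hkl
    by_contra h0
    exact hkl ((hk' k l i j h0 hij).trans hsum)
  set b := B (weightVec r 0) (weightVec r r) with hb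
  have hzero : power r 1 0 = weightVec r 0 := by
    rw [power, Finset.sum_eq_single 0]
    · simp
    · intro k _ hk
      simp [Fin.val_ne_zero_iff.mpr hk]
    · simp
  have h0t : ∀ t, B (power r 1 0) (power r 1 t) = b * t ^ r := by
    intro t
    rw [hzero, power, map_sum, Finset.sum_eq_single (Fin.last r)]
    · simp [hb, mul_comm]
    · intro k _ hk
      rw [map_smul, hanti, smul_zero]
      intro h0
      exact hk (Fin.ext (by simpa using h0))
    · simp
  have hst : ∀ s t, B (power r 1 s) (power r 1 t) = b * (t - s) ^ r := by
    intro s t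
    by_cases hs : s = 0
    · rw [hs, h0t, sub_zero]
    obtain ⟨e, -, heB⟩ := exists_semiinvariant hQ h !![1, 0; s, 1] (by simp)
    have heB' : ∀ u v, B (power r 1 (s + u)) (power r 1 (s + v)) =
        e * B (power r 1 u) (power r 1 v) := by
      intro u v
      have := heB (power r 1 u) (power r 1 v)
      rw [← hB, symPow_power, symPow_power] at this
      simpa using this
    -- The first shift gives `e * b * (t - s) ^ r`. The second lands on the known pair `(0, s)` and,
    -- as `r` is even and `s ≠ 0`, yields `e * b = b`; the multiplier itself need not be computed.
    have h1 := heB' 0 (t - s)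
    have h2 := heB' (-s) 0
    rw [add_neg_cancel, add_zero, h0t, hsymm, h0t] at h2
    rw [add_zero, add_sub_cancel, h0t] at h1
    rw [hr.neg_pow, ← mul_assoc] at h2
    rw [h1, ← mul_assoc, ← mul_right_cancel₀ (pow_ne_zero r hs) h2]
  have hBb : B = b • invForm r := bilin_ext_power fun s t => by
    rw [hst]
    simp [invForm_power]
  refine ⟨b, fun h0 => hB0 (by rw [hBb, h0, zero_smul]), QuadraticMap.ext fun v => ?_⟩
  rw [← hBQ, hBb]
  rfl

/-! ### The Zariski topology and irreducibility of the quadric -/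

lemma eval_smul_of_isHomogeneous {n d : ℕ} {F : MvPolynomial (Fin n) ℂ} (hF : F.IsHomogeneous d)
    (c : ℂ) (x : Fin n → ℂ) : eval (c • x) F = c ^ d * eval x F := by
  rw [eval_eq', eval_eq', Finset.mul_sum]
  refine Finset.sum_congr rfl fun e he => ?_
  have hdeg : ∑ i, e i = d := by
    have := hF (mem_support_iff.mp he)
    simpa [Finsupp.weight_apply, Finsupp.sum_fintype] using this
  simp only [Pi.smul_apply, smul_eq_mul, mul_pow, Finset.prod_mul_distrib, Finset.prod_pow_eq_pow_sum,
    hdeg]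
  ring

/-- The open subset `F ≠ 0` of `ℙ^r`. -/
def basicOpen (r : ℕ) (F : MvPolynomial (Fin (r + 1)) ℂ) : Set (ℙ ℂ (BinForm r)) :=
  {p | eval ((weightBasis r).equivFun p.rep) F ≠ 0}

lemma isOpen_basicOpen {r d : ℕ} {F : MvPolynomial (Fin (r + 1)) ℂ} (hF : F.IsHomogeneous d) :
    IsOpen (basicOpen r F) :=
  TopologicalSpace.isOpen_generateFrom_of_mem ⟨d, F, hF, rfl⟩

lemma mk_mem_basicOpen {r d : ℕ} {F : MvPolynomial (Fin (r + 1)) ℂ} (hF : F.IsHomogeneous d)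
    (v : BinForm r) (hv : v ≠ 0) : Projectivization.mk ℂ v hv ∈ basicOpen r F ↔
      eval ((weightBasis r).equivFun v) F ≠ 0 := by
  obtain ⟨a, ha⟩ := Projectivization.exists_smul_eq_mk_rep ℂ v hv
  change eval ((weightBasis r).equivFun (Projectivization.mk ℂ v hv).rep) F ≠ 0 ↔ _
  rw [← ha, Units.smul_def, map_smul, eval_smul_of_isHomogeneous hF]
  simp

lemma isTopologicalBasis_basicOpen (r : ℕ) : TopologicalSpace.IsTopologicalBasis
    {U : Set (ℙ ℂ (BinForm r)) | ∃ (d : ℕ) (F : MvPolynomial (Fin (r + 1)) ℂ),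
      F.IsHomogeneous d ∧ U = basicOpen r F} where
  exists_subset_inter := by
    rintro _ ⟨d, F, hF, rfl⟩ _ ⟨e, G, hG, rfl⟩ p hp
    refine ⟨_, ⟨d + e, F * G, hF.mul hG, rfl⟩, ?_, ?_⟩
    · simpa [basicOpen] using hp
    · intro q hq
      simpa [basicOpen] using hq
  sUnion_eq := by
    refine Set.eq_univ_of_forall fun p => ⟨_, ⟨0, 1, isHomogeneous_one _ _, rfl⟩, ?_⟩
    simp [basicOpen]
  eq_generateFrom := rfl

lemma exists_basicOpen_subset {r : ℕ} {U : Set (ℙ ℂ (BinForm r))} (hU : IsOpen U)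
    {p : ℙ ℂ (BinForm r)} (hp : p ∈ U) : ∃ (d : ℕ) (F : MvPolynomial (Fin (r + 1)) ℂ),
      F.IsHomogeneous d ∧ p ∈ basicOpen r F ∧ basicOpen r F ⊆ U := by
  obtain ⟨_, ⟨d, F, hF, rfl⟩, h1, h2⟩ :=
    (isTopologicalBasis_basicOpen r).exists_subset_of_mem_open hp hU
  exact ⟨d, F, hF, h1, h2⟩

lemma isClosed_zeroLocus_invForm (r : ℕ) :
    IsClosed (zeroLocus (invForm r).toQuadraticMap) := by
  have hF : (∑ i : Fin (r + 1), C ((-1) ^ (i : ℕ) * (r.choose i : ℂ)) * (X i * X i.rev) :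
      MvPolynomial (Fin (r + 1)) ℂ).IsHomogeneous 2 :=
    IsHomogeneous.sum _ _ _ fun i _ =>
      IsHomogeneous.C_mul ((isHomogeneous_X _ _).mul (isHomogeneous_X _ _)) _
  rw [← isOpen_compl_iff]
  convert isOpen_basicOpen hF using 1
  ext p
  simp [basicOpen, zeroLocus, invForm_apply, mul_assoc]

/-- If any two points of `S` lie on a conic, or a line, contained in `S`, then `S` is irreducible. -/
lemma isIrreducible_of_curves {r : ℕ} {S : Set (ℙ ℂ (BinForm r))} (hne : S.Nonempty)
    (h : ∀ p ∈ S, ∀ q ∈ S, ∃ a b c : BinForm r,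
      (∃ h0 : a ≠ 0, Projectivization.mk ℂ a h0 = p) ∧
      (∃ h1 : a + b + c ≠ 0, Projectivization.mk ℂ (a + b + c) h1 = q) ∧
      ∀ (s : ℂ) (hs : a + s • b + s ^ 2 • c ≠ 0), Projectivization.mk ℂ _ hs ∈ S) :
    IsIrreducible S := by
  refine ⟨hne, fun U V hU hV ⟨p, hpS, hpU⟩ ⟨q, hqS, hqV⟩ => ?_⟩
  obtain ⟨d, F, hF, hpF, hFU⟩ := exists_basicOpen_subset hU hpU
  obtain ⟨e, G, hG, hqG, hGV⟩ := exists_basicOpen_subset hV hqV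
  obtain ⟨a, b, c, ⟨ha, rfl⟩, ⟨habc, rfl⟩, hS⟩ := h p hpS q hqS
  rw [mk_mem_basicOpen hF] at hpF
  rw [mk_mem_basicOpen hG] at hqG
  set x := (weightBasis r).equivFun
  let γ : Fin (r + 1) → Polynomial ℂ := fun i => Polynomial.C (x a i) +
    Polynomial.X * Polynomial.C (x b i) + Polynomial.X ^ 2 * Polynomial.C (x c i)
  have hγ : ∀ (s : ℂ) (P : MvPolynomial (Fin (r + 1)) ℂ),
      (aeval γ P).eval s = eval (x (a + s • b + s ^ 2 • c)) P := by
    intro s P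
    have : (Polynomial.evalRingHom s).comp (aeval γ : MvPolynomial (Fin (r + 1)) ℂ →ₐ[ℂ]
        Polynomial ℂ).toRingHom = eval (x (a + s • b + s ^ 2 • c)) := by
      apply MvPolynomial.ringHom_ext
      · intro k; simp
      · intro i; simp [γ]; ring
    exact RingHom.congr_fun this P
  -- Including this coordinate in the product below keeps the chosen parameter away from those where
  -- the curve passes through the zero vector.
  obtain ⟨i, hi⟩ : ∃ i, x a i ≠ 0 := by
    by_contra! h0
    exact ha (x.injective (by ext i; simp [h0 i]))
  have h1 : aeval γ F ≠ 0 := fun h0 => hpF (by simpa [h0] using (hγ 0 F).symm)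
  have h2 : aeval γ G ≠ 0 := fun h0 => hqG (by simpa [h0] using (hγ 1 G).symm)
  have h3 : aeval γ (X i : MvPolynomial _ ℂ) ≠ 0 := fun h0 => hi (by
    have := hγ 0 (X i)
    rw [h0] at this
    simpa using this.symm)
  obtain ⟨s, hs⟩ : ∃ s : ℂ,
      Polynomial.eval s (aeval γ F * aeval γ G * aeval γ (X i : MvPolynomial _ ℂ)) ≠ 0 := by
    by_contra! h0
    exact mul_ne_zero (mul_ne_zero h1 h2) h3 (Polynomial.funext (by simpa using h0))
  rw [Polynomial.eval_mul, Polynomial.eval_mul, hγ, hγ, hγ] at hs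
  have hs0 : a + s • b + s ^ 2 • c ≠ 0 := by
    intro h0
    simp [h0] at hs
  refine ⟨_, hS s hs0, hFU ?_, hGV ?_⟩
  · rw [mk_mem_basicOpen hF]
    exact left_ne_zero_of_mul (left_ne_zero_of_mul hs)
  · rw [mk_mem_basicOpen hG]
    exact right_ne_zero_of_mul (left_ne_zero_of_mul hs)

lemma exists_power_invForm_ne_zero {r : ℕ} {v w : BinForm r} (hv : v ≠ 0)
    (hw : w ≠ 0) : ∃ t : ℂ, invForm r v (power r 1 t) ≠ 0 ∧ invForm r w (power r 1 t) ≠ 0 := by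
  have key : ∀ u : BinForm r, u ≠ 0 → (∑ i : Fin (r + 1),
      Polynomial.C (invForm r u (weightVec r i)) * Polynomial.X ^ (i : ℕ)) ≠ 0 := by
    intro u hu h0
    have : invForm r u = 0 := eq_zero_of_power _ fun t => by rw [map_power, h0, Polynomial.eval_zero]
    exact hu (eq_zero_of_invForm fun w => by rw [this]; rfl)
  by_contra! h0
  refine mul_ne_zero (key v hv) (key w hw) (Polynomial.funext fun t => ?_)
  rw [Polynomial.eval_mul, ← map_power, ← map_power, Polynomial.eval_zero, mul_eq_zero]
  by_cases h : invForm r v (power r 1 t) = 0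
  · exact Or.inl h
  · exact Or.inr (h0 t h)

/-- Choose an isotropic power `y` not orthogonal to `v` or `w`. The map `u ↦ q(u,u) y - 2 q(u,y) u`
sends `u` to the further intersection of the line `yu` with the quadric, and fixes the points of `v`
and `w`. Applied to the line from `v` to `w = v + d` it gives a curve quadratic in the parameter and
contained in the quadric. -/
lemma isIrreducible_zeroLocus_invForm {r : ℕ} (hr : Even r) (hr0 : r ≠ 0) :
    IsIrreducible (zeroLocus (invForm r).toQuadraticMap) := by
  have hx0 : weightVec r 0 ≠ 0 := by
    intro h
    have := invForm_weightVec r 0 r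
    simp [h] at this
  refine isIrreducible_of_curves ⟨Projectivization.mk ℂ _ hx0, ?_⟩ ?_
  · rw [mk_mem_zeroLocus]
    change invForm r _ _ = 0
    rw [invForm_weightVec, if_neg (by omega)]
  intro p hp q hq
  induction p using Projectivization.ind with | h v hv => ?_
  induction q using Projectivization.ind with | h w hw => ?_
  rw [mk_mem_zeroLocus] at hp hq
  change invForm r v v = 0 at hp
  change invForm r w w = 0 at hq
  obtain ⟨t, hvt, hwt⟩ := exists_power_invForm_ne_zero hv hw
  set y := power r 1 t
  have hy : invForm r y y = 0 := by
    rw [invForm_power, sub_eq_zero.mpr (by ring), zero_pow hr0]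
  set q := invForm r
  obtain ⟨d, rfl⟩ : ∃ d, w = v + d := ⟨w - v, by abel⟩
  have hsum : (-(2 * q v y)) • v + ((2 * q v d) • y - (2 * q v y) • d - (2 * q d y) • v) +
      (q d d • y - (2 * q d y) • d) = (-(2 * q (v + d) y)) • (v + d) := by
    have h1 : q (v + d) (v + d) = 2 * q v d + q d d := by
      simp only [map_add, LinearMap.add_apply, hp, invForm_symm hr d v, q]
      ring
    rw [hq] at h1
    have h2 : q d d = - (2 * q v d) := by linear_combination -h1
    rw [h2, map_add, LinearMap.add_apply]
    module
  have hne : ∀ u, q u y ≠ 0 → -(2 * q u y) ≠ 0 := fun u hu =>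
    neg_ne_zero.mpr (mul_ne_zero two_ne_zero hu)
  refine ⟨(-(2 * q v y)) • v, (2 * q v d) • y - (2 * q v y) • d - (2 * q d y) • v,
    q d d • y - (2 * q d y) • d, ⟨smul_ne_zero (hne v hvt) hv, ?_⟩, ?_, ?_⟩
  · rw [Projectivization.mk_eq_mk_iff']
    exact ⟨_, rfl⟩
  · simp only [hsum]
    refine ⟨smul_ne_zero (hne _ hwt) hw, ?_⟩
    rw [Projectivization.mk_eq_mk_iff']
    exact ⟨_, rfl⟩
  · intro s hs
    rw [mk_mem_zeroLocus]
    have hcurve : (-(2 * q v y)) • v + s • ((2 * q v d) • y - (2 * q v y) • d - (2 * q d y) • v) +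
        s ^ 2 • (q d d • y - (2 * q d y) • d) =
        q (v + s • d) (v + s • d) • y - (2 * q (v + s • d) y) • (v + s • d) := by
      simp only [map_add, map_smul, LinearMap.add_apply, LinearMap.smul_apply, hp, smul_eq_mul,
        show q d v = q v d from invForm_symm hr d v]
      module
    rw [hcurve]
    set u := v + s • d
    change q _ _ = 0
    simp only [map_sub, map_smul, LinearMap.sub_apply, LinearMap.smul_apply, smul_eq_mul, hy,
      show q y u = q u y from invForm_symm hr y u]
    ring

/-! ### Vanishing ideals and the upper bound for the dimension -/

/-- The polynomial `s ↦ F(s x)`. -/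
def restrictLine {n : ℕ} (F : MvPolynomial (Fin n) ℂ) (x : Fin n → ℂ) : Polynomial ℂ :=
  ∑ k ∈ Finset.range (F.totalDegree + 1),
    Polynomial.C (eval x (homogeneousComponent k F)) * Polynomial.X ^ k

lemma eval_restrictLine {n : ℕ} (F : MvPolynomial (Fin n) ℂ) (x : Fin n → ℂ) (s : ℂ) :
    (restrictLine F x).eval s = eval (s • x) F := by
  conv_rhs => rw [← sum_homogeneousComponent F]
  rw [restrictLine, Polynomial.eval_finsetSum, map_sum]
  refine Finset.sum_congr rfl fun k _ => ?_
  rw [eval_smul_of_isHomogeneous (homogeneousComponent_isHomogeneous k F)]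
  simp only [Polynomial.eval_mul, Polynomial.eval_C, Polynomial.eval_pow, Polynomial.eval_X]
  ring

lemma restrictLine_ne_zero {n d : ℕ} {F : MvPolynomial (Fin n) ℂ} {x : Fin n → ℂ}
    (h : eval x (homogeneousComponent d F) ≠ 0) : restrictLine F x ≠ 0 := by
  intro h0
  have hc := congrArg (fun p => Polynomial.coeff p d) h0
  simp only [restrictLine, Polynomial.finsetSum_coeff, Polynomial.coeff_C_mul_X_pow,
    Polynomial.coeff_zero, Finset.sum_ite_eq, Finset.mem_range] at hc
  split_ifs at hc with hd
  · exact h hc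
  · rw [homogeneousComponent_eq_zero _ _ (by omega), map_zero] at h
    exact h rfl

lemma exists_homogeneousComponent_ne_zero {n : ℕ} {F : MvPolynomial (Fin n) ℂ} {x : Fin n → ℂ}
    (h : eval x F ≠ 0) : ∃ d, eval x (homogeneousComponent d F) ≠ 0 := by
  by_contra! h0
  rw [← sum_homogeneousComponent F, map_sum] at h
  exact h (Finset.sum_eq_zero fun k _ => h0 k)

/-- The ideal of polynomials vanishing on the cone over `Z`. -/
def vanishingIdeal {r : ℕ} (Z : Set (ℙ ℂ (BinForm r))) : Ideal (MvPolynomial (Fin (r + 1)) ℂ) where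
  carrier := {F | ∀ (v : BinForm r) (hv : v ≠ 0), Projectivization.mk ℂ v hv ∈ Z →
    eval ((weightBasis r).equivFun v) F = 0}
  add_mem' hF hG v hv hZ := by rw [map_add, hF v hv hZ, hG v hv hZ, add_zero]
  zero_mem' v hv hZ := map_zero _
  smul_mem' c F hF v hv hZ := by rw [smul_eq_mul, map_mul, hF v hv hZ, mul_zero]

lemma mem_vanishingIdeal {r : ℕ} {Z : Set (ℙ ℂ (BinForm r))} {F : MvPolynomial (Fin (r + 1)) ℂ} :
    F ∈ vanishingIdeal Z ↔ ∀ (v : BinForm r) (hv : v ≠ 0), Projectivization.mk ℂ v hv ∈ Z →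
      eval ((weightBasis r).equivFun v) F = 0 := Iff.rfl

/-- If `F` and `G` are outside the ideal, each has a homogeneous component not vanishing on all of
`Z`, and irreducibility gives one point where both components are nonzero. On the line through it
`F` and `G` restrict to nonzero polynomials, whose product would vanish at every `s ≠ 0`; the extra
factor `X` covers `s = 0`. -/
lemma vanishingIdeal_isPrime {r : ℕ} {Z : Set (ℙ ℂ (BinForm r))} (hZ : IsIrreducible Z) :
    (vanishingIdeal Z).IsPrime where
  ne_top' := by
    obtain ⟨p, hp⟩ := hZ.1
    rw [Ideal.ne_top_iff_one]
    intro h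
    have := h p.rep p.rep_nonzero (by rwa [p.mk_rep])
    simp at this
  mem_or_mem' := by
    intro F G hFG
    by_contra! hcon
    obtain ⟨hF, hG⟩ := hcon
    simp only [mem_vanishingIdeal, not_forall] at hF hG
    obtain ⟨v, hv, hvZ, hvF⟩ := hF
    obtain ⟨w, hw, hwZ, hwG⟩ := hG
    obtain ⟨d, hd⟩ := exists_homogeneousComponent_ne_zero hvF
    obtain ⟨e, he⟩ := exists_homogeneousComponent_ne_zero hwG
    have hFd := homogeneousComponent_isHomogeneous d F
    have hGe := homogeneousComponent_isHomogeneous e G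
    obtain ⟨p, hpZ, hpF, hpG⟩ := hZ.2 _ _ (isOpen_basicOpen hFd) (isOpen_basicOpen hGe)
      ⟨_, hvZ, (mk_mem_basicOpen hFd v hv).mpr hd⟩ ⟨_, hwZ, (mk_mem_basicOpen hGe w hw).mpr he⟩
    have hne := mul_ne_zero (mul_ne_zero (restrictLine_ne_zero hpF) (restrictLine_ne_zero hpG))
      (Polynomial.X_ne_zero (R := ℂ))
    refine hne (Polynomial.funext fun s => ?_)
    rw [Polynomial.eval_mul, Polynomial.eval_mul, eval_restrictLine, eval_restrictLine, ← map_mul,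
      Polynomial.eval_X, Polynomial.eval_zero]
    by_cases hs : s = 0
    · rw [hs, mul_zero]
    · rw [← map_smul, hFG _ (smul_ne_zero hs p.rep_nonzero), zero_mul]
      rw [← p.mk_rep] at hpZ
      convert! hpZ using 1
      rw [Projectivization.mk_eq_mk_iff']
      exact ⟨s, rfl⟩

lemma vanishingIdeal_lt {r : ℕ} {Z₁ Z₂ : Set (ℙ ℂ (BinForm r))} (hZ₁ : IsClosed Z₁)
    (h : Z₁ ⊂ Z₂) : vanishingIdeal Z₂ < vanishingIdeal Z₁ := by
  refine lt_of_le_not_ge (fun F hF v hv hvZ => hF v hv (h.1 hvZ)) fun hle => ?_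
  obtain ⟨p, hp2, hp1⟩ := Set.exists_of_ssubset h
  obtain ⟨d, F, hF, hpF, hsub⟩ := exists_basicOpen_subset hZ₁.isOpen_compl hp1
  refine hpF (hle (x := F) (fun v hv hvZ => ?_) p.rep p.rep_nonzero (by rwa [p.mk_rep]))
  by_contra h0
  exact hsub ((mk_mem_basicOpen hF v hv).mpr h0) hvZ

/-- The ideal of polynomials without constant term. -/
def irrelevantIdeal (r : ℕ) : Ideal (MvPolynomial (Fin (r + 1)) ℂ) :=
  RingHom.ker (eval (0 : Fin (r + 1) → ℂ))

lemma vanishingIdeal_lt_irrelevantIdeal {r : ℕ} {Z : Set (ℙ ℂ (BinForm r))} (hZ : Z.Nonempty) :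
    vanishingIdeal Z < irrelevantIdeal r := by
  obtain ⟨p, hp⟩ := hZ
  refine lt_of_le_not_ge (fun F hF => ?_) fun hle => ?_
  · rw [irrelevantIdeal, RingHom.mem_ker]
    by_contra h0
    have hd : eval ((weightBasis r).equivFun p.rep) (homogeneousComponent 0 F) ≠ 0 := by
      simpa [constantCoeff_eq] using h0
    refine mul_ne_zero (restrictLine_ne_zero hd) (Polynomial.X_ne_zero (R := ℂ))
      (Polynomial.funext fun s => ?_)
    rw [Polynomial.eval_mul, eval_restrictLine, Polynomial.eval_X, Polynomial.eval_zero]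
    by_cases hs : s = 0
    · rw [hs, mul_zero]
    · rw [← map_smul, hF _ (smul_ne_zero hs p.rep_nonzero), zero_mul]
      rw [← p.mk_rep] at hp
      convert! hp using 1
      rw [Projectivization.mk_eq_mk_iff']
      exact ⟨s, rfl⟩
  · refine p.rep_nonzero ((weightBasis r).equivFun.injective (funext fun i => ?_))
    have : X i ∈ irrelevantIdeal r := by simp [irrelevantIdeal, RingHom.mem_ker]
    have := hle this p.rep p.rep_nonzero (by rwa [p.mk_rep])
    simpa using this

lemma topologicalKrullDim_le {r n : ℕ} (hn : r = n + 1) {S : Set (ℙ ℂ (BinForm r))}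
    (hS : IsClosed S) {F : MvPolynomial (Fin (r + 1)) ℂ} (hF : F ≠ 0) (hFS : F ∈ vanishingIdeal S) :
    topologicalKrullDim S ≤ n := by
  let R := MvPolynomial (Fin (r + 1)) ℂ
  have hval : Topology.IsInducing (Subtype.val : S → ℙ ℂ (BinForm r)) := .subtypeVal
  let J : TopologicalSpace.IrreducibleCloseds S → (PrimeSpectrum R)ᵒᵈ := fun Z =>
    OrderDual.toDual ⟨vanishingIdeal (closure (Subtype.val '' (Z : Set S))),
      vanishingIdeal_isPrime (TopologicalSpace.IrreducibleCloseds.map _ hval.continuous Z).isIrreducible⟩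
  have hJ : StrictMono J := by
    intro Z₁ Z₂ h
    rw [OrderDual.toDual_lt_toDual, ← PrimeSpectrum.asIdeal_lt_asIdeal]
    exact vanishingIdeal_lt isClosed_closure
      (TopologicalSpace.IrreducibleCloseds.map_strictMono_of_isInducing hval h)
  have hirr : (irrelevantIdeal r).IsPrime := RingHom.ker_isPrime _
  have hlt : ∀ Z, OrderDual.toDual (⟨irrelevantIdeal r, hirr⟩ : PrimeSpectrum R) < J Z := fun Z => by
    rw [OrderDual.toDual_lt_toDual, ← PrimeSpectrum.asIdeal_lt_asIdeal]
    exact vanishingIdeal_lt_irrelevantIdeal (Z.isIrreducible.nonempty.image _).closure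
  have hgt : ∀ Z, J Z < OrderDual.toDual (⊥ : PrimeSpectrum R) := fun Z => by
    rw [OrderDual.toDual_lt_toDual, ← PrimeSpectrum.asIdeal_lt_asIdeal]
    refine bot_lt_iff_ne_bot.mpr fun h0 => hF ?_
    rw [← Ideal.mem_bot, ← h0]
    exact fun v hv hvZ => hFS v hv
      (closure_minimal (Subtype.coe_image_subset S (Z : Set S)) hS hvZ)
  refine iSup_le fun p => ?_
  -- The chain of primes is extended by the irrelevant ideal at one end and the zero ideal at the
  -- other. Its length `p.length + 2` is at most `r + 1`, which gives the bound `r - 1`.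
  let q := ((p.map J hJ).cons _ (by rw [LTSeries.head_map]; exact hlt _)).snoc
    (OrderDual.toDual (⊥ : PrimeSpectrum R)) (by
      rw [RelSeries.last_cons, LTSeries.last_map]; exact hgt _)
  have hq := Order.LTSeries.length_le_krullDim q
  rw [Order.krullDim_orderDual] at hq
  change _ ≤ ringKrullDim R at hq
  rw [MvPolynomial.ringKrullDim_of_isNoetherianRing, ringKrullDim_eq_zero_of_field, zero_add,
    Nat.card_fin] at hq
  have hlen : q.length = p.length + 2 := by simp [q]
  rw [hlen] at hq
  have : p.length + 2 ≤ r + 1 := by exact_mod_cast hq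
  have : p.length ≤ n := by omega
  exact_mod_cast this

/-! ### The affine chart and the lower bound for the dimension -/

lemma equivFun_weightVec {r j : ℕ} (hj : j ≤ r) (i : Fin (r + 1)) :
    (weightBasis r).equivFun (weightVec r j) i = if (i : ℕ) = j then 1 else 0 := by
  have h : weightVec r j = weightBasis r ⟨j, Nat.lt_succ_of_le hj⟩ := by rw [weightBasis_apply]
  rw [h, Module.Basis.equivFun_self]
  simp [Fin.ext_iff, eq_comm]

lemma invForm_weightVec_last {r : ℕ} (v : BinForm r) :
    invForm r v (weightVec r r) = (weightBasis r).equivFun v 0 := by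
  simpa using invForm_apply_weightVec (Nat.zero_le r) v

/-- The correction of the last coordinate of `y` which makes it isotropic, if `y₀ = 1`. -/
def chart (r : ℕ) (y : BinForm r) : BinForm r :=
  y - (invForm r y y / 2) • weightVec r r

lemma equivFun_chart {r : ℕ} (y : BinForm r) (i : Fin (r + 1)) (hi : (i : ℕ) ≠ r) :
    (weightBasis r).equivFun (chart r y) i = (weightBasis r).equivFun y i := by
  simp [chart, equivFun_weightVec le_rfl, hi, - Module.Basis.equivFun_apply]

lemma chart_ne_zero {r : ℕ} (hr : r ≠ 0) {y : BinForm r} (hy : (weightBasis r).equivFun y 0 = 1) :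
    chart r y ≠ 0 := by
  intro h
  have := equivFun_chart y 0 (by simpa using hr.symm)
  rw [h, hy] at this
  simp at this

lemma invForm_chart {r : ℕ} (hr : Even r) (hr0 : r ≠ 0) {y : BinForm r}
    (hy : (weightBasis r).equivFun y 0 = 1) : invForm r (chart r y) (chart r y) = 0 := by
  have h1 : invForm r (weightVec r r) (weightVec r r) = 0 := by
    rw [invForm_weightVec, if_neg (by omega)]
  simp only [chart, map_sub, map_smul, LinearMap.sub_apply, LinearMap.smul_apply, smul_eq_mul, h1,
    invForm_symm hr (weightVec r r) y, invForm_weightVec_last, hy]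
  ring

/-- The image under the chart of the vectors `(1, y₁, …, y_k, 0, …, 0)`. -/
def chartSet (r k : ℕ) : Set (ℙ ℂ (BinForm r)) :=
  {p | ∃ (y : BinForm r) (h : chart r y ≠ 0), (weightBasis r).equivFun y 0 = 1 ∧
    (∀ i : Fin (r + 1), k < i → (weightBasis r).equivFun y i = 0) ∧
    p = Projectivization.mk ℂ _ h}

lemma chartSet_subset {r : ℕ} (hr : Even r) (hr0 : r ≠ 0) (k : ℕ) :
    closure (chartSet r k) ⊆ zeroLocus (invForm r).toQuadraticMap := by
  refine closure_minimal ?_ (isClosed_zeroLocus_invForm r)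
  rintro _ ⟨y, h, hy, -, rfl⟩
  rw [mk_mem_zeroLocus]
  exact invForm_chart hr hr0 hy

/-- The vectors `(1, y₁, …, y_k, 0, …, 0)` form an affine space, and `chart` is quadratic, so it
carries each line there to a curve of degree at most two. -/
lemma isIrreducible_chartSet {r : ℕ} (hr : Even r) (hr0 : r ≠ 0) (k : ℕ) :
    IsIrreducible (chartSet r k) := by
  have h0 : (weightBasis r).equivFun (weightVec r 0) 0 = 1 := by
    simp [equivFun_weightVec (Nat.zero_le r), - Module.Basis.equivFun_apply]
  refine isIrreducible_of_curves ⟨_, weightVec r 0, chart_ne_zero hr0 h0, h0, fun i hi => ?_, rfl⟩ ?_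
  · rw [equivFun_weightVec (Nat.zero_le r), if_neg (by omega)]
  rintro _ ⟨y, hy, hy0, hyk, rfl⟩ _ ⟨z, hz, hz0, hzk, rfl⟩
  obtain ⟨d, rfl⟩ : ∃ d, z = y + d := ⟨z - y, by abel⟩
  have key : ∀ s : ℂ, chart r y + s • (d - invForm r y d • weightVec r r) +
      s ^ 2 • (-(invForm r d d / 2) • weightVec r r) = chart r (y + s • d) := by
    intro s
    simp only [chart, map_add, map_smul, LinearMap.add_apply, LinearMap.smul_apply, smul_eq_mul,
      invForm_symm hr d y]
    module
  refine ⟨chart r y, d - invForm r y d • weightVec r r, -(invForm r d d / 2) • weightVec r r,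
    ⟨hy, rfl⟩, ?_, ?_⟩
  · have h1 := key 1
    rw [one_smul, one_pow, one_smul, one_smul] at h1
    simp only [h1]
    exact ⟨hz, trivial⟩
  · intro s hs
    simp only [map_add, Pi.add_apply, hy0, add_eq_left] at hz0
    refine ⟨y + s • d, by rwa [← key], ?_, fun i hi => ?_, by simp only [key]⟩
    · rw [map_add, map_smul, Pi.add_apply, Pi.smul_apply, hy0, hz0, smul_zero, add_zero]
    · have := hzk i hi
      rw [map_add, Pi.add_apply, hyk i hi, zero_add] at this
      rw [map_add, map_smul, Pi.add_apply, Pi.smul_apply, hyk i hi, this, smul_zero, add_zero]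

/-- The coordinate `a_{k+1}` vanishes on the smaller set but not at the image of `x₀ + x_{k+1}`; as
`k + 1 < r`, the correction in the last coordinate does not affect it. -/
lemma closure_chartSet_ssubset {r k : ℕ} (hk : k + 1 < r) :
    closure (chartSet r k) ⊂ closure (chartSet r (k + 1)) := by
  have hX : (X ⟨k + 1, by omega⟩ : MvPolynomial (Fin (r + 1)) ℂ).IsHomogeneous 1 :=
    isHomogeneous_X _ _
  refine ⟨closure_mono fun p ⟨y, h, h0, hi, hp⟩ => ⟨y, h, h0, fun i hki => hi i (by omega), hp⟩,
    fun hsub => ?_⟩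
  have hclosed : closure (chartSet r k) ⊆ (basicOpen r (X ⟨k + 1, by omega⟩))ᶜ := by
    refine closure_minimal ?_ (isOpen_basicOpen hX).isClosed_compl
    rintro _ ⟨y, h, h0, hi, rfl⟩ hmem
    rw [mk_mem_basicOpen hX, eval_X, equivFun_chart _ _ (by simp; omega)] at hmem
    exact hmem (hi _ (by simp))
  let y := weightVec r 0 + weightVec r (k + 1)
  have hy : ∀ i, (weightBasis r).equivFun y i =
      (if (i : ℕ) = 0 then 1 else 0) + if (i : ℕ) = k + 1 then 1 else 0 := fun i => by
    rw [map_add, Pi.add_apply, equivFun_weightVec (Nat.zero_le r), equivFun_weightVec (by omega)]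
  have hy0 : (weightBasis r).equivFun y 0 = 1 := by rw [hy]; simp
  have hne := chart_ne_zero (by omega) hy0
  refine hclosed (hsub (subset_closure ⟨y, hne, hy0, fun i hi => ?_, rfl⟩)) ?_
  · rw [hy, if_neg (by omega), if_neg (by omega), add_zero]
  · rw [mk_mem_basicOpen hX, eval_X, equivFun_chart _ _ (by simp; omega), hy]
    simp

lemma isIrreducible_preimage_val {α : Type*} [TopologicalSpace α] {M Z : Set α} (h : Z ⊆ M)
    (hZ : IsIrreducible Z) : IsIrreducible (Subtype.val ⁻¹' Z : Set M) := by
  obtain ⟨⟨x, hx⟩, hZ⟩ := hZ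
  refine ⟨⟨⟨x, h hx⟩, hx⟩, ?_⟩
  rintro _ _ ⟨U, hU, rfl⟩ ⟨V, hV, rfl⟩ ⟨a, ha, haU⟩ ⟨b, hb, hbV⟩
  obtain ⟨c, hc, hcU, hcV⟩ := hZ U V hU hV ⟨a, ha, haU⟩ ⟨b, hb, hbV⟩
  exact ⟨⟨c, h hc⟩, hc, hcU, hcV⟩

lemma topologicalKrullDim_zeroLocus_invForm {r : ℕ} (hr : Even r) (hr0 : r ≠ 0) :
    topologicalKrullDim (zeroLocus (invForm r).toQuadraticMap) = ((r - 1 : ℕ) : WithBot ℕ∞) := by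
  obtain ⟨n, rfl⟩ := Nat.exists_eq_succ_of_ne_zero hr0
  set M := zeroLocus (invForm (n + 1)).toQuadraticMap
  apply le_antisymm
  · let F : MvPolynomial (Fin (n + 1 + 1)) ℂ := ∑ i : Fin (n + 1 + 1),
      C ((-1) ^ (i : ℕ) * ((n + 1).choose i : ℂ)) * (X i * X i.rev)
    have hF : ∀ v, eval ((weightBasis (n + 1)).equivFun v) F = invForm (n + 1) v v := fun v => by
      simp [F, invForm_apply, mul_assoc]
    refine topologicalKrullDim_le rfl (isClosed_zeroLocus_invForm _) (F := F) (fun h0 => ?_)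
      fun v hv hvM => ?_
    -- The form takes the value `2` at `x₀ + x_r`, since `r` is even.
    · have h1 := hF (weightVec (n + 1) 0 + weightVec (n + 1) (n + 1))
      simp only [h0, map_zero, map_add, LinearMap.add_apply, invForm_weightVec] at h1
      simp [hr.neg_one_pow] at h1
      norm_num at h1
    · rw [hF]
      exact (mk_mem_zeroLocus _ v hv).mp hvM
  -- The indices `k = 0, …, r - 1` give `r` sets, so a chain of length `r - 1`.
  · let Z : Fin (n + 1) → TopologicalSpace.IrreducibleCloseds M := fun k =>
      ⟨Subtype.val ⁻¹' closure (chartSet (n + 1) k), isIrreducible_preimage_val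
        (chartSet_subset hr hr0 k) (isIrreducible_chartSet hr hr0 k).closure,
        isClosed_closure.preimage continuous_subtype_val⟩
    have hZ : StrictMono Z := by
      rw [Fin.strictMono_iff_lt_succ]
      intro i
      have hss := closure_chartSet_ssubset (r := n + 1) (k := i) (by omega)
      refine lt_of_le_not_ge (fun x hx => hss.1 hx) fun hle => hss.2 fun x hx => ?_
      exact hle (x := ⟨x, chartSet_subset hr hr0 _ hx⟩) hx
    exact Order.LTSeries.length_le_krullDim (LTSeries.mk n Z hZ)

/-! ### Osculating varieties -/

lemma iteratedDeriv_pow_eq (i k : ℕ) : iteratedDeriv k (fun s : ℂ => s ^ i) =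
    fun t => (i.descFactorial k : ℂ) * t ^ (i - k) := by
  induction k with
  | zero => simp
  | succ k ih =>
    rw [iteratedDeriv_succ, ih]
    funext t
    rw [deriv_const_mul _ (by fun_prop), deriv_pow_field, Nat.descFactorial_succ, Nat.sub_sub]
    push_cast
    ring

lemma equivFun_curveDeriv (r k : ℕ) (t : ℂ) (i : Fin (r + 1)) :
    (weightBasis r).equivFun (curveDeriv r k t) i =
      ((i : ℕ).descFactorial k : ℂ) * t ^ ((i : ℕ) - k) := by
  rw [curveDeriv, LinearEquiv.apply_symm_apply, iteratedDeriv_pow_eq]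

lemma curveDeriv_zero (r : ℕ) (t : ℂ) : curveDeriv r 0 t = power r 1 t := by
  apply (weightBasis r).equivFun.injective
  ext i
  rw [equivFun_curveDeriv, equivFun_power]
  simp

/-- On the powers this is the expansion of `(t + s) ^ j`, and powers span. -/
lemma equivFun_symPow_unipotent {r : ℕ} (t : ℂ) (v : BinForm r) (j : Fin (r + 1)) :
    (weightBasis r).equivFun (symPow r !![1, 0; t, 1] v) j =
      ∑ a : Fin (r + 1), ((j : ℕ).choose a * t ^ ((j : ℕ) - a)) * (weightBasis r).equivFun v a := by
  let e := (weightBasis r).equivFun.toLinearMap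
  let f : BinForm r →ₗ[ℂ] ℂ := LinearMap.proj j ∘ₗ e ∘ₗ symPow r !![1, 0; t, 1] -
    ∑ a : Fin (r + 1), ((j : ℕ).choose a * t ^ ((j : ℕ) - a)) • (LinearMap.proj a ∘ₗ e)
  have hf : ∀ v, f v = (weightBasis r).equivFun (symPow r !![1, 0; t, 1] v) j -
      ∑ a : Fin (r + 1), ((j : ℕ).choose a * t ^ ((j : ℕ) - a)) *
        (weightBasis r).equivFun v a := fun v => by
    simp [f, e]
  have h0 : f = 0 := eq_zero_of_power f fun s => by
    rw [hf, symPow_power, equivFun_power, sub_eq_zero]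
    have hj : (j : ℕ) + 1 ≤ r + 1 := j.2
    simp only [equivFun_power, one_pow, one_mul]
    rw [← Finset.sum_range (fun a => ((j : ℕ).choose a * t ^ ((j : ℕ) - a)) * s ^ a),
      ← Finset.sum_subset (Finset.range_subset_range.mpr hj)]
    · simp [add_comm t s, add_pow]
      refine Finset.sum_congr rfl fun a _ => ?_
      ring
    · intro a _ ha
      rw [Nat.choose_eq_zero_of_lt (by simpa using ha)]
      simp
  have := LinearMap.congr_fun h0 v
  rw [hf] at this
  exact sub_eq_zero.mp this

/-- The unipotent matrix translates the parameter of the curve by `t`, and the `k`-th derivative at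
`0` is `k! x_k`. -/
lemma curveDeriv_eq_symPow {r k : ℕ} (hk : k ≤ r) (t : ℂ) :
    curveDeriv r k t = symPow r !![1, 0; t, 1] ((k ! : ℂ) • weightVec r k) := by
  apply (weightBasis r).equivFun.injective
  ext j
  rw [equivFun_curveDeriv, equivFun_symPow_unipotent, Finset.sum_eq_single ⟨k, by omega⟩]
  · rw [map_smul, Pi.smul_apply, equivFun_weightVec hk, if_pos rfl,
      Nat.descFactorial_eq_factorial_mul_choose]
    simp only [smul_eq_mul]
    push_cast
    ring
  · intro a _ ha
    rw [map_smul, Pi.smul_apply, equivFun_weightVec hk, if_neg, smul_zero, mul_zero]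
    exact fun h => ha (Fin.ext h)
  · simp

/-- After a unipotent translation the point lies in the span of `x₀, …, x_p`, where no two indices
add up to `r`. -/
lemma osculatingVariety_subset {r p : ℕ} (hp : 2 * p < r) :
    osculatingVariety r p ⊆ zeroLocus (invForm r).toQuadraticMap := by
  refine closure_minimal ?_ (isClosed_zeroLocus_invForm r)
  rintro _ ⟨t, l, h, rfl⟩
  rw [mk_mem_zeroLocus]
  let w : BinForm r := ((0 ! : ℕ) : ℂ) • weightVec r 0 +
    ∑ j : Fin p, l j • (((j + 1 : ℕ)! : ℂ) • weightVec r (j + 1))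
  have hw : curveDeriv r 0 t + ∑ j : Fin p, l j • curveDeriv r (j + 1) t =
      symPow r !![1, 0; t, 1] w := by
    rw [map_add, map_sum, curveDeriv_eq_symPow (Nat.zero_le r)]
    congr 1
    refine Finset.sum_congr rfl fun j _ => ?_
    rw [map_smul, curveDeriv_eq_symPow (by omega)]
  have hw0 : ∀ i : Fin (r + 1), p < i → (weightBasis r).equivFun w i = 0 := by
    intro i hi
    rw [map_add, map_sum, map_smul, Pi.add_apply, Pi.smul_apply, equivFun_weightVec (Nat.zero_le r),
      if_neg (by omega), smul_zero, zero_add, Finset.sum_apply]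
    refine Finset.sum_eq_zero fun j _ => ?_
    rw [map_smul, map_smul, Pi.smul_apply, Pi.smul_apply, equivFun_weightVec (by omega),
      if_neg (by omega), smul_zero, smul_zero]
  change invForm r _ _ = 0
  rw [hw, invForm_symPow, invForm_apply]
  refine mul_eq_zero_of_right _ (Finset.sum_eq_zero fun i _ => ?_)
  have hrev : ((i.rev : Fin (r + 1)) : ℕ) = r - i := by simp [Fin.val_rev]
  rcases lt_or_ge p (i : ℕ) with h1 | h1
  · rw [hw0 i h1, mul_zero, zero_mul]
  · rw [hw0 i.rev (by omega), mul_zero]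

/-- Homogenization with respect to the coordinate `a₀` of a polynomial in `a₁, …, a_n`. -/
lemma exists_homogenization {n : ℕ} (G : MvPolynomial (Fin n) ℂ) :
    ∃ (d : ℕ) (F : MvPolynomial (Fin (n + 1 + 1)) ℂ), F.IsHomogeneous d ∧
      ∀ x : Fin (n + 1 + 1) → ℂ, x 0 = 1 → eval x F = eval (fun i => x i.castSucc.succ) G := by
  refine ⟨G.totalDegree, ∑ k ∈ Finset.range (G.totalDegree + 1), X 0 ^ (G.totalDegree - k) *
    rename (fun i : Fin n => i.castSucc.succ) (homogeneousComponent k G), ?_, fun x hx => ?_⟩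
  · refine IsHomogeneous.sum _ _ _ fun k hk => ?_
    have := (isHomogeneous_X_pow (R := ℂ) (0 : Fin (n + 1 + 1)) (G.totalDegree - k)).mul
      ((homogeneousComponent_isHomogeneous k G).rename_isHomogeneous
        (f := fun i : Fin n => i.castSucc.succ))
    rwa [Nat.sub_add_cancel (Nat.lt_succ_iff.mp (Finset.mem_range.mp hk))] at this
  · conv_rhs => rw [← sum_homogeneousComponent G]
    rw [map_sum, map_sum]
    refine Finset.sum_congr rfl fun k _ => ?_
    rw [map_mul, map_pow, eval_X, hx, one_pow, one_mul, eval_rename]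
    rfl

/-- The polynomial ring in `p + 1` variables has transcendence degree `p + 1`. -/
lemma exists_ne_zero_vanishing {n p : ℕ} (h : p + 1 < n)
    (P : Fin n → MvPolynomial (Option (Fin p)) ℂ) :
    ∃ G : MvPolynomial (Fin n) ℂ, G ≠ 0 ∧ aeval P G = 0 := by
  by_contra! hcon
  have hP : AlgebraicIndependent ℂ P := by
    rw [algebraicIndependent_iff]
    intro G hG
    by_contra h0
    exact hcon G h0 hG
  have := hP.cardinalMk_le_trdeg
  rw [MvPolynomial.trdeg_of_isDomain] at this
  simp at this
  norm_cast at this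
  omega

/-- On the osculating points `a₁, …, a_{r-1}` are polynomials in the `p + 1` parameters `t, l`, so
they satisfy a nontrivial relation `G`. On the quadric with `a₀ = 1` these coordinates are
arbitrary, so `G` does not vanish there identically. -/
lemma osculatingVariety_ssubset {r p : ℕ} (hr : Even r) (hp : 2 * p < r) (hp' : p + 2 < r) :
    osculatingVariety r p ⊂ zeroLocus (invForm r).toQuadraticMap := by
  refine ⟨osculatingVariety_subset hp, fun hsub => ?_⟩
  obtain ⟨n, rfl⟩ := Nat.exists_eq_succ_of_ne_zero (show r ≠ 0 by omega)
  let P : Fin n → MvPolynomial (Option (Fin p)) ℂ := fun i => X none ^ ((i : ℕ) + 1) +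
    ∑ j : Fin p, X (some j) * (C (((i : ℕ) + 1).descFactorial (j + 1) : ℂ) *
      X none ^ ((i : ℕ) + 1 - (j + 1)))
  obtain ⟨G, hG0, hG⟩ := exists_ne_zero_vanishing (by omega) P
  obtain ⟨d, F, hF, hFG⟩ := exists_homogenization G
  obtain ⟨b, hb⟩ : ∃ b, eval b G ≠ 0 := by
    by_contra! h0
    exact hG0 (MvPolynomial.funext (by simpa using h0))
  have hclosed : osculatingVariety (n + 1) p ⊆ (basicOpen (n + 1) F)ᶜ := by
    refine closure_minimal ?_ (isOpen_basicOpen hF).isClosed_compl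
    rintro _ ⟨t, l, h, rfl⟩ hmem
    rw [mk_mem_basicOpen hF] at hmem
    have hcoord : ∀ i : Fin (n + 1 + 1), (weightBasis (n + 1)).equivFun
        (curveDeriv (n + 1) 0 t + ∑ j : Fin p, l j • curveDeriv (n + 1) (j + 1) t) i =
        t ^ (i : ℕ) + ∑ j : Fin p, l j * (((i : ℕ).descFactorial (j + 1) : ℂ) *
          t ^ ((i : ℕ) - (j + 1))) := by
      intro i
      rw [map_add, map_sum, Pi.add_apply, Finset.sum_apply, equivFun_curveDeriv]
      simp only [map_smul, Pi.smul_apply, equivFun_curveDeriv, smul_eq_mul]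
      simp
    rw [hFG _ (by rw [hcoord]; simp)] at hmem
    apply hmem
    have h1 : eval (fun o : Option (Fin p) => o.elim t l) (aeval P G) = 0 := by rw [hG, map_zero]
    have h2 : (eval (fun o : Option (Fin p) => o.elim t l)).comp (aeval P : MvPolynomial (Fin n) ℂ
        →ₐ[ℂ] MvPolynomial (Option (Fin p)) ℂ).toRingHom =
        eval fun i => (weightBasis (n + 1)).equivFun (curveDeriv (n + 1) 0 t +
          ∑ j : Fin p, l j • curveDeriv (n + 1) (j + 1) t) i.castSucc.succ := by
      apply MvPolynomial.ringHom_ext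
      · intro k; simp
      · intro i; rw [eval_X, hcoord]; simp [P]
    rw [← h2]
    exact h1
  -- The last entry is arbitrary, since `chart` replaces it by the value that puts the point on the
  -- quadric.
  let y : BinForm (n + 1) := (weightBasis (n + 1)).equivFun.symm
    (Fin.cons 1 (Fin.snoc b 0 : Fin (n + 1) → ℂ))
  have hy : (weightBasis (n + 1)).equivFun y =
      (Fin.cons 1 (Fin.snoc b 0 : Fin (n + 1) → ℂ) : Fin (n + 1 + 1) → ℂ) :=
    LinearEquiv.apply_symm_apply _ _
  have hy0 : (weightBasis (n + 1)).equivFun y 0 = 1 := by rw [hy]; rfl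
  have hne := chart_ne_zero (by omega) hy0
  have hmem : Projectivization.mk ℂ _ hne ∈ zeroLocus (invForm (n + 1)).toQuadraticMap := by
    rw [mk_mem_zeroLocus]
    exact invForm_chart hr (by omega) hy0
  refine hclosed (hsub hmem) ?_
  rw [mk_mem_basicOpen hF, hFG _ (by rw [equivFun_chart _ _ (by simp), hy0])]
  have hcoord : (fun i : Fin n => (weightBasis (n + 1)).equivFun (chart (n + 1) y) i.castSucc.succ) =
      b := by
    funext i
    rw [equivFun_chart _ _ (by simp; omega), hy, Fin.cons_succ, Fin.snoc_castSucc]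
  rwa [hcoord]

/-! ### The conic case, nondegeneracy, and the main theorem -/

lemma veroneseCurve_two : veroneseCurve 2 = zeroLocus (invForm 2).toQuadraticMap := by
  apply subset_antisymm
  · refine closure_minimal ?_ (isClosed_zeroLocus_invForm 2)
    rintro _ ⟨t, h, rfl⟩
    rw [mk_mem_zeroLocus, curveDeriv_zero]
    change invForm 2 _ _ = 0
    rw [invForm_power]
    ring
  · have hX : (X 0 : MvPolynomial (Fin (2 + 1)) ℂ).IsHomogeneous 1 := isHomogeneous_X _ _
    have hirr := isIrreducible_zeroLocus_invForm (r := 2) even_two two_ne_zero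
    have h0 : weightVec 2 0 ≠ 0 := by
      intro h
      have := invForm_weightVec 2 0 2
      simp [h] at this
    have hne : (zeroLocus (invForm 2).toQuadraticMap ∩ basicOpen 2 (X 0)).Nonempty := by
      refine ⟨Projectivization.mk ℂ _ h0, ?_, ?_⟩
      · rw [mk_mem_zeroLocus]
        change invForm 2 _ _ = 0
        rw [invForm_weightVec, if_neg (by omega)]
      · rw [mk_mem_basicOpen hX, eval_X, equivFun_weightVec (Nat.zero_le 2)]
        simp
    -- The part `a₀ ≠ 0` is dense in the irreducible conic, and there `a₀ a₂ = a₁²` exhibits each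
    -- point as `c₂(a₁ / a₀)`.
    refine (subset_closure_inter_of_isPreirreducible_of_isOpen hirr.2 (isOpen_basicOpen hX)
      hne).trans (closure_mono ?_)
    rintro p ⟨hp, hp0⟩
    induction p using Projectivization.ind with | h v hv => ?_
    rw [mk_mem_zeroLocus] at hp
    change invForm 2 v v = 0 at hp
    rw [mk_mem_basicOpen hX, eval_X] at hp0
    rw [invForm_apply] at hp
    set x := (weightBasis 2).equivFun v with hx
    have hrev0 : Fin.rev (0 : Fin 3) = 2 := rfl
    have hrev1 : Fin.rev (1 : Fin 3) = 1 := rfl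
    have hrev2 : Fin.rev (2 : Fin 3) = 0 := rfl
    simp [Fin.sum_univ_three, hrev0, hrev1, hrev2] at hp
    have hv' : v = x 0 • power 2 1 (x 1 / x 0) := by
      apply (weightBasis 2).equivFun.injective
      ext i
      rw [map_smul, Pi.smul_apply, equivFun_power, ← hx, smul_eq_mul]
      fin_cases i
      · simp
      · simp; field_simp
      · simp; field_simp; linear_combination hp / 2
    have hpow : curveDeriv 2 0 (x 1 / x 0) ≠ 0 := by
      rw [curveDeriv_zero]
      intro h
      rw [h, smul_zero] at hv'
      exact hv hv'
    refine ⟨x 1 / x 0, hpow, ?_⟩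
    rw [Projectivization.mk_eq_mk_iff']
    exact ⟨x 0, by rw [curveDeriv_zero, ← hv']⟩

lemma rank_toMatrix_smul_invForm (r : ℕ) {c : ℂ} (hc : c ≠ 0) :
    (LinearMap.BilinForm.toMatrix (weightBasis r) (c • invForm r)).rank = r + 1 := by
  rw [Matrix.rank_of_isUnit, Fintype.card_fin]
  rw [Matrix.isUnit_iff_isUnit_det, isUnit_iff_ne_zero,
    ← LinearMap.BilinForm.nondegenerate_iff_det_ne_zero]
  have : Module.Finite ℂ (BinForm r) := .of_basis (weightBasis r)
  refine LinearMap.BilinForm.Nondegenerate.ofSeparatingLeft fun v hv => ?_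
  exact eq_zero_of_invForm fun w => by simpa [hc] using hv w

lemma isPGLInvariant_iff {r : ℕ} (hr : Even r) {Q : QuadraticForm ℂ (BinForm r)} (hQ : Q ≠ 0)
    {lam : ℂ} (hlam : lam ≠ 0) : IsPGLInvariant (zeroLocus Q) ↔
      ∃ c : ℂ, c ≠ 0 ∧ Q = c • (lam • invForm r).toQuadraticMap := by
  constructor
  · intro h
    obtain ⟨c, hc, rfl⟩ := eq_smul_of_isPGLInvariant hr hQ h
    refine ⟨c / lam, div_ne_zero hc hlam, QuadraticMap.ext fun v => ?_⟩
    simp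
    field_simp
  · rintro ⟨c, hc, rfl⟩
    rw [zeroLocus_smul _ hc, LinearMap.BilinMap.toQuadraticMap_smul, zeroLocus_smul _ hlam]
    exact isPGLInvariant_invForm r

lemma toQuadraticMap_invForm_ne_zero {r : ℕ} (hr : Even r) (hr0 : r ≠ 0) :
    (invForm r).toQuadraticMap ≠ 0 := by
  intro h
  have h1 : invForm r (weightVec r 0 + weightVec r r) (weightVec r 0 + weightVec r r) = 0 :=
    QuadraticMap.congr_fun h (weightVec r 0 + weightVec r r)
  simp only [map_add, LinearMap.add_apply, invForm_weightVec] at h1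
  simp [hr.neg_one_pow, hr0, hr0.symm] at h1

theorem IsProjection.exists_invariant_form {r : ℕ} (hr : Even r) (hr0 : r ≠ 0)
    {f : BinForm r →ₗ[ℂ] BinForm r →ₗ[ℂ] BinForm 0} (hf : IsProjection f) :
      ∃ (q : LinearMap.BilinForm ℂ (BinForm r)) (lam : ℂ),
        (∀ v w, f v w = q v w • weightVec 0 0) ∧
        variety f = zeroLocus q.toQuadraticMap ∧
        lam ≠ 0 ∧
        LinearMap.BilinForm.toMatrix (weightBasis r) q =
          Matrix.of (fun i j : Fin (r + 1) =>
            if (i : ℕ) + (j : ℕ) = r then lam * (-1) ^ (i : ℕ) * (r.choose i : ℂ) else 0) ∧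
        (LinearMap.BilinForm.toMatrix (weightBasis r) q).rank = r + 1 ∧
        (∀ Z : Set (ℙ ℂ (BinForm r)), IsQuadric Z ∧ IsPGLInvariant Z ↔ Z = variety f) ∧
        (∀ Q : QuadraticForm ℂ (BinForm r), Q ≠ 0 →
          (IsPGLInvariant (zeroLocus Q) ↔ ∃ c : ℂ, c ≠ 0 ∧ Q = c • q.toQuadraticMap)) ∧
        IsIrreducible (variety f) ∧
        topologicalKrullDim (variety f) = ((r - 1 : ℕ) : WithBot ℕ∞) ∧
        (2 < r → osculatingVariety r (r / 2 - 1) ⊂ variety f) ∧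
        (r = 2 → veroneseCurve r = variety f) := by
  obtain ⟨lam, hlam, hq⟩ := hf.exists_eq_smul
  have hx : weightVec 0 0 ≠ 0 := by
    intro h
    have := coord_weightVec 0 0 0
    simp [h] at this
  have hvar : variety f = zeroLocus (lam • invForm r).toQuadraticMap := by
    ext p
    change f p.rep p.rep = 0 ↔ (lam • invForm r) p.rep p.rep = 0
    rw [hq, smul_eq_zero_iff_left hx]
  have hvar' : variety f = zeroLocus (invForm r).toQuadraticMap := by
    rw [hvar, LinearMap.BilinMap.toQuadraticMap_smul, zeroLocus_smul _ hlam]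
  refine ⟨lam • invForm r, lam, hq, hvar, hlam, ?_, rank_toMatrix_smul_invForm r hlam, fun Z => ?_,
    fun Q hQ => isPGLInvariant_iff hr hQ hlam, ?_, ?_, fun h => ?_, ?_⟩
  · rw [map_smul, toMatrix_invForm]
    ext i j
    simp [mul_assoc]
  · constructor
    · rintro ⟨⟨Q, hQ, rfl⟩, hZ⟩
      obtain ⟨c, hc, rfl⟩ := eq_smul_of_isPGLInvariant hr hQ hZ
      rw [hvar', zeroLocus_smul _ hc]
    · rintro rfl
      rw [hvar']
      exact ⟨⟨_, toQuadraticMap_invForm_ne_zero hr hr0, rfl⟩, isPGLInvariant_invForm r⟩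
  · rw [hvar']
    exact isIrreducible_zeroLocus_invForm hr hr0
  · rw [hvar']
    exact topologicalKrullDim_zeroLocus_invForm hr hr0
  · rw [hvar']
    exact osculatingVariety_ssubset hr (by omega) (by omega)
  · rintro rfl
    rw [hvar', veroneseCurve_two]

end BinaryForms

end

open BinaryForms in
theorem mainTheorem9 (r m : ℕ) (hr : 2 ≤ r) (hm : r = 2 * m) :
    (∃ f : BinForm r →ₗ[ℂ] BinForm r →ₗ[ℂ] BinForm (2 * r - 4 * m), IsProjection f) ∧
    ∀ f : BinForm r →ₗ[ℂ] BinForm r →ₗ[ℂ] BinForm (2 * r - 4 * m), IsProjection f →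
      ∃ (q : LinearMap.BilinForm ℂ (BinForm r)) (lam : ℂ),
        -- there is exactly one equation: `f = q w₀`, with `S^{2r-4m}(ℂ²)` spanned by `w₀`
        (∀ v w, f v w = q v w • weightVec (2 * r - 4 * m) 0) ∧
        variety f = zeroLocus q.toQuadraticMap ∧
        -- the matrix of `q` in the basis `x₀, …, x_r`
        lam ≠ 0 ∧
        LinearMap.BilinForm.toMatrix (weightBasis r) q =
          Matrix.of (fun i j : Fin (r + 1) =>
            if (i : ℕ) + (j : ℕ) = r then lam * (-1) ^ (i : ℕ) * (r.choose i : ℂ) else 0) ∧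
        (LinearMap.BilinForm.toMatrix (weightBasis r) q).rank = r + 1 ∧
        -- `M_m` is the only invariant quadric, and `q` its only equation up to scalars
        (∀ Z : Set (ℙ ℂ (BinForm r)), IsQuadric Z ∧ IsPGLInvariant Z ↔ Z = variety f) ∧
        (∀ Q : QuadraticForm ℂ (BinForm r), Q ≠ 0 →
          (IsPGLInvariant (zeroLocus Q) ↔ ∃ c : ℂ, c ≠ 0 ∧ Q = c • q.toQuadraticMap)) ∧
        -- irreducibility and dimension
        IsIrreducible (variety f) ∧
        topologicalKrullDim (variety f) = ((r - 1 : ℕ) : WithBot ℕ∞) ∧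
        -- relation with the osculating varieties of the Veronese curve
        (2 < r → osculatingVariety r (r / 2 - 1) ⊂ variety f) ∧
        (r = 2 → veroneseCurve r = variety f) := by
  have h : 2 * r - 4 * m = 0 := by omega
  have hr' : Even r := ⟨m, by omega⟩
  -- The degree occurs in the types, so it is made a variable before being replaced by `0`.
  generalize 2 * r - 4 * m = n at h ⊢
  subst h
  exact ⟨exists_isProjection_zero hr', fun f hf => hf.exists_invariant_form hr' (by omega)⟩
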